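/- Definitions. A short partition of $\mathbb R$ is given by points $\dots<a_{-1}<a_0=0<a_1<\dots$ such that the intervals $S_n=(a_n,a_{n+1}]$ satisfy $|S_n|\to\infty$ as $n\to\pm\infty$ and $\sum_n \frac{|S_n|^2}{1+\operatorname{dist}^2(0,S_n)}<\infty$. For a finite set $F\subset\mathbb R$ put $E(F)=\sum\log|x-y|$, the sum over all ordered pairs of distinct points $x,y\in F$. For $d>0$, a sequence $\Lambda$ of distinct real points without finite accumulation points is called $d$-uniform if there is a short partition $\{S_n\}$ such that, with $\Delta_n=\#(\Lambda\cap S_n)$, $$\Delta_n=d|S_n|+o(|S_n|)\ \text{ as } n\to\pm\infty\qquad\text{and}\qquad \sum_n\frac{\Delta_n^2\log|S_n|-E(\Lambda\cap S_n)}{1+\operatorname{dist}^2(0,S_n)}<\infty .$$ Lemma. Let $\Lambda=\{\lambda_n\}_{n\in\mathbb Z}$, enumerated in increasing order, be a $c$-uniform sequence and let $\Gamma$ be a $d$-uniform sequence. Let $\{I_n\}_{n\in\mathbb Z}$ be a sequence of disjoint intervals of positive length such that $I_n$ is centered at $\lambda_n$, $$|I_n|\le\tfrac13\operatorname{dist}(\lambda_n,\Lambda\setminus\{\lambda_n\})\qquad\text{and}\qquad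 \sum_n\frac{\log|I_n|}{1+n^2}>-\infty .$$ Suppose that $\Gamma\cap\bigcup_n I_n=\emptyset$. Then $\Lambda\cup\Gamma$ contains a $(c+d)$-uniform subsequence. -/

import Mathlib

namespace UniformSequences

/-- The `n`-th interval `(a n, a (n + 1)]` of the partition of the line with division points `a`. -/
def piece (a : ℤ → ℝ) (n : ℤ) : Set ℝ := Set.Ioc (a n) (a (n + 1))

/-- The length of the `n`-th interval. -/
def len (a : ℤ → ℝ) (n : ℤ) : ℝ := a (n + 1) - a n

/-- The denominator `1 + dist(0, I_n)^2`. -/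
noncomputable def weight (a : ℤ → ℝ) (n : ℤ) : ℝ := 1 + Metric.infDist 0 (piece a n) ^ 2

/-- The division points `... < a (-1) < a 0 = 0 < a 1 < ...` form a short partition of the line:
the lengths tend to infinity in both directions and
`∑ |I_n|^2 / (1 + dist(0, I_n)^2)` is finite. -/
structure IsShortPartition (a : ℤ → ℝ) : Prop where
  strictMono : StrictMono a
  zero : a 0 = 0
  len_tendsto : Filter.Tendsto (len a) (Filter.atBot ⊔ Filter.atTop) Filter.atTop
  short : Summable fun n : ℤ => len a n ^ 2 / weight a n

/-- The logarithmic energy `E(S) = ∑ log |x - y|` of a finite set `S`, the sum being over all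
ordered pairs of distinct points of `S`. -/
noncomputable def logEnergy (S : Set ℝ) : ℝ :=
  ∑ᶠ p ∈ S.offDiag, Real.log |p.1 - p.2|

/-- The number of points of `L` in the `n`-th interval. -/
noncomputable def count (L : Set ℝ) (a : ℤ → ℝ) (n : ℤ) : ℝ := ((L ∩ piece a n).ncard : ℝ)

/-- `#(L ∩ I_n) = d |I_n| + o(|I_n|)` as `n → ±∞`. -/
def DensityCondition (d : ℝ) (L : Set ℝ) (a : ℤ → ℝ) : Prop :=
  (fun n : ℤ => count L a n - d * len a n) =o[Filter.atBot ⊔ Filter.atTop] len a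

/-- `∑ (Δ_n^2 log |I_n| - E(L ∩ I_n)) / (1 + dist(0, I_n)^2) < ∞`. A term with `|I_n| ≥ 1` is
nonnegative, and all but finitely many intervals of a short partition are that long, so
the sum is finite exactly if the terms are summable. -/
def EnergyCondition (L : Set ℝ) (a : ℤ → ℝ) : Prop :=
  Summable fun n : ℤ =>
    (count L a n ^ 2 * Real.log (len a n) - logEnergy (L ∩ piece a n)) / weight a n

/-- A `d`-uniform sequence of distinct real points, given as the set `L` of its points. -/
structure IsUniform (d : ℝ) (L : Set ℝ) : Prop where
  pos : 0 < d
  /-- There are no finite accumulation points. -/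
  discrete : ∀ x : ℝ, ¬ AccPt x (Filter.principal L)
  exists_partition : ∃ a : ℤ → ℝ,
    IsShortPartition a ∧ DensityCondition d L a ∧ EnergyCondition L a

end UniformSequences

/-! The two energies can be combined only on one partition. A partition `u` is built greedily whose
intervals are longer than every interval of either given partition that they meet, and eventually
much longer. It can be kept short because a convergent series stays convergent after multiplication
by suitable factors tending to infinity (`exists_common_coarsening`).

Coarsening creates new pairs: points of different old intervals, possibly extremely close across a
division point. Therefore the last point of each sequence in each of its old intervals is deleted
(`dropLast`). One point per interval is negligible against the length, so the density survives. If a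
window contains kept points of two different old intervals, it also contains the deleted last point
of the left one. Hence its pairs are dominated by pairs of the original set inside single old
intervals plus the squared length of the window (`card_offDiag_dropLast_le`).

Pair counts in windows control energies: up to additive and multiplicative constants, `log (R / |x -
y|)` is the number of overlapping dyadic cells containing both points (`sum_log_div_le`).

The same principle treats the union (`excess_union_le`). A window with `p` points of one set and `q`
of the other has at most `3p(p-1) + 3q(q-1) + 3` ordered pairs when `p, q ≥ 1`. The last `3` is
charged to a point `lam n` in the window with `ℓ n / 2` below the window length. Summed over dyadic
windows, the charges cost about `log (R / ℓ n)` per point, which is summable by the logarithmic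
hypothesis because `1 + n ^ 2` is bounded by a multiple of the weight of the interval holding `lam
n`. -/

namespace UniformSequences
open Filter Set

/-! ### Elementary facts on partitions, weights and counting -/

variable {a : ℤ → ℝ} {L : Set ℝ}

theorem len_pos (ha : StrictMono a) (n : ℤ) : 0 < len a n :=
  sub_pos.2 (ha (by lia))

theorem infDist_piece_le (ha : StrictMono a) {n : ℤ} {y : ℝ} (h₁ : a n ≤ y) (h₂ : y ≤ a (n + 1)) :
    Metric.infDist 0 (piece a n) ≤ |y| := by
  have hlt : a n ≠ a (n + 1) := (ha (by lia : n < n + 1)).ne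
  rw [piece, ← Metric.infDist_closure, closure_Ioc hlt]
  simpa [Real.dist_eq] using Metric.infDist_le_dist_of_mem (x := (0 : ℝ)) (show y ∈ Icc (a n) (a (n + 1)) from ⟨h₁, h₂⟩)

theorem abs_le_infDist_piece_add_len (ha : StrictMono a) {n : ℤ} {y : ℝ} (h₁ : a n ≤ y)
    (h₂ : y ≤ a (n + 1)) : |y| ≤ Metric.infDist 0 (piece a n) + len a n := by
  have hlt : a n < a (n + 1) := ha (by lia)
  have : |y| - len a n ≤ Metric.infDist 0 (piece a n) := by
    rw [Metric.le_infDist (show (piece a n).Nonempty from ⟨_, hlt, le_rfl⟩)]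
    rintro z ⟨hz₁, hz₂⟩
    have hyz : |y - z| ≤ len a n := by rw [abs_le, len]; constructor <;> linarith
    have := abs_sub_abs_le_abs_sub y z
    simp only [dist_zero_left, Real.norm_eq_abs]
    linarith
  linarith

theorem one_le_weight (a : ℤ → ℝ) (n : ℤ) : 1 ≤ weight a n := by
  unfold weight; nlinarith [sq_nonneg (Metric.infDist 0 (piece a n))]

theorem weight_pos (a : ℤ → ℝ) (n : ℤ) : 0 < weight a n := zero_lt_one.trans_le (one_le_weight a n)

namespace IsShortPartition

theorem len_tendsto_cofinite (ha : IsShortPartition a) : Tendsto (len a) cofinite atTop := by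
  rw [Int.cofinite_eq]; exact ha.len_tendsto

theorem exists_le_len (ha : IsShortPartition a) : ∃ m > 0, ∀ n, m ≤ len a n := by
  obtain ⟨n, hn⟩ := ha.len_tendsto_cofinite.exists_forall_le
  exact ⟨len a n, len_pos ha.strictMono n, hn⟩

theorem exists_len_le (ha : IsShortPartition a) :
    ∃ C > 0, ∀ n, len a n ^ 2 ≤ C * weight a n := by
  refine ⟨∑' n, len a n ^ 2 / weight a n + 1, ?_, fun n => ?_⟩
  · have : 0 ≤ ∑' n, len a n ^ 2 / weight a n :=
      tsum_nonneg fun n => div_nonneg (sq_nonneg _) (weight_pos a n).le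
    linarith
  · rw [← div_le_iff₀ (weight_pos a n)]
    have := ha.short.le_tsum n fun j _ => div_nonneg (sq_nonneg _) (weight_pos a j).le
    linarith

/-- Lengths tending to infinity are bounded below by some `m > 0`, so the division points are
unbounded in both directions. -/
theorem exists_mem_piece (ha : IsShortPartition a) (x : ℝ) : ∃ n, x ∈ piece a n := by
  obtain ⟨m, hm, hlen⟩ := ha.exists_le_len
  have hstep : ∀ n : ℤ, a n + m ≤ a (n + 1) := fun n => by
    have := hlen n; unfold len at this; linarith
  have hpos : ∀ n : ℕ, (n : ℝ) * m ≤ a n := fun n => by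
    induction n with
    | zero => simp [ha.zero]
    | succ k ih => have := hstep k; push_cast; linarith
  have hneg : ∀ n : ℕ, a (-n : ℤ) ≤ -((n : ℝ) * m) := fun n => by
    induction n with
    | zero => simp [ha.zero]
    | succ k ih =>
      have := hstep (-(k + 1 : ℤ))
      rw [show (-(k + 1 : ℤ) + 1) = -(k : ℤ) by ring] at this
      push_cast; linarith
  obtain ⟨k, hk⟩ := exists_nat_gt (|x| / m)
  rw [div_lt_iff₀ hm] at hk
  have hx := abs_lt.1 hk
  obtain ⟨n, hn, hmax⟩ := Int.exists_greatest_of_bdd (P := fun n => a n < x)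
    ⟨k, fun z hz => by
      by_contra! h
      have := ha.strictMono h
      have := hpos k
      linarith⟩ ⟨-k, by have := hneg k; linarith⟩
  refine ⟨n, hn, ?_⟩
  by_contra! h
  have := hmax _ h
  lia

theorem summable_const_div_weight (ha : IsShortPartition a) :
    Summable fun n => 1 / weight a n := by
  obtain ⟨m, hm, hlen⟩ := ha.exists_le_len
  refine Summable.of_nonneg_of_le (fun n => by have := weight_pos a n; positivity) (fun n => ?_)
    (ha.short.mul_left (1 / m ^ 2))
  have := weight_pos a n
  rw [← mul_div_assoc]
  gcongr
  rw [one_div, inv_mul_eq_div, le_div_iff₀ (by positivity)]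
  have := hlen n
  nlinarith

end IsShortPartition

theorem eq_of_mem_piece (ha : StrictMono a) {m n : ℤ} {x : ℝ} (hm : x ∈ piece a m)
    (hn : x ∈ piece a n) : m = n := by
  by_contra hne
  rcases lt_or_gt_of_ne hne with h | h
  · have := ha.monotone (show m + 1 ≤ n by lia)
    have := hm.2; have := hn.1; linarith
  · have := ha.monotone (show n + 1 ≤ m by lia)
    have := hn.2; have := hm.1; linarith

theorem le_of_mem_piece (ha : StrictMono a) {m n : ℤ} {x y : ℝ} (hm : x ∈ piece a m)
    (hn : y ∈ piece a n) (hxy : x ≤ y) : m ≤ n := by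
  by_contra! h
  have := ha.monotone (show n + 1 ≤ m by lia)
  have := hn.2; have := hm.1; linarith

theorem finite_inter_Icc (hL : ∀ x : ℝ, ¬ AccPt x (𝓟 L)) (x y : ℝ) : (L ∩ Icc x y).Finite := by
  by_contra h
  obtain ⟨z, -, hz⟩ := Set.Infinite.exists_accPt_of_subset_isCompact h isCompact_Icc inter_subset_right
  exact hL z (hz.mono (principal_mono.2 inter_subset_left))

theorem finite_inter_Ioc (hL : ∀ x : ℝ, ¬ AccPt x (𝓟 L)) (x y : ℝ) : (L ∩ Ioc x y).Finite :=
  (finite_inter_Icc hL x y).subset (inter_subset_inter_right _ Ioc_subset_Icc_self)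

theorem DensityCondition.exists_count_le {d : ℝ} (h : DensityCondition d L a) (ha : StrictMono a) :
    ∃ D > 0, ∀ n, count L a n ≤ D * len a n := by
  have h' : (fun n : ℤ => count L a n - d * len a n) =O[cofinite] len a := by
    rw [Int.cofinite_eq]; exact h.isBigO
  obtain ⟨C, hC, hb⟩ := Asymptotics.bound_of_isBigO_cofinite h'
  refine ⟨C + |d|, by positivity, fun n => ?_⟩
  have hp := len_pos ha n
  have := hb hp.ne'
  rw [Real.norm_eq_abs, Real.norm_eq_abs, abs_of_pos hp] at this
  have := (abs_le.1 this).2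
  nlinarith [le_abs_self d]

theorem sum_len_Ico (a : ℤ → ℝ) {m n : ℤ} (h : m ≤ n) :
    ∑ i ∈ Finset.Ico m n, len a i = a n - a m := by
  induction n, h using Int.leInduction with
  | base => simp
  | succ n hn ih =>
    rw [← Finset.insert_Ico_right_eq_Ico_add_one hn, Finset.sum_insert (by simp), ih, len]; ring

theorem ncard_Ioc_eq_sum (ha : StrictMono a) (hL : ∀ x : ℝ, ¬ AccPt x (𝓟 L)) {m n : ℤ}
    (h : m ≤ n) : ((L ∩ Ioc (a m) (a n)).ncard : ℝ) = ∑ i ∈ Finset.Ico m n, count L a i := by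
  induction n, h using Int.leInduction with
  | base => simp
  | succ n hn ih =>
    rw [← Finset.insert_Ico_right_eq_Ico_add_one hn, Finset.sum_insert (by simp), ← ih, count, piece,
      ← Nat.cast_add, ← Set.ncard_union_eq _ (finite_inter_Ioc hL _ _) (finite_inter_Ioc hL _ _),
      ← inter_union_distrib_left, union_comm,
      Ioc_union_Ioc_eq_Ioc (ha.monotone hn) (ha.monotone (by lia))]
    exact (Ioc_disjoint_Ioc_of_le le_rfl).symm.mono inter_subset_right inter_subset_right

theorem ncard_Ioc_le (ha : StrictMono a) (hL : ∀ x : ℝ, ¬ AccPt x (𝓟 L)) {D : ℝ}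
    (hD : ∀ n, count L a n ≤ D * len a n) {m n : ℤ} (h : m ≤ n) :
    ((L ∩ Ioc (a m) (a n)).ncard : ℝ) ≤ D * (a n - a m) := by
  rw [ncard_Ioc_eq_sum ha hL h, ← sum_len_Ico a h, Finset.mul_sum]
  exact Finset.sum_le_sum fun i _ => hD i

end UniformSequences

/-! ### Bounded-multiplicity summation and greedy choice of division points -/

namespace UniformSequences
open Filter Set

/-- Double counting: each `f i` is used at most `N` times. This transfers convergence from the old
intervals, or from the indices of single points, to the intervals of the coarser partition. -/
theorem summable_sum_of_multiplicity_le {κ ι : Type*} [DecidableEq ι] {f : ι → ℝ}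
    (hf₀ : ∀ i, 0 ≤ f i) (hf : Summable f) (M : κ → Finset ι) (N : ℕ)
    (hM : ∀ (i : ι) (K : Finset κ), (∀ k ∈ K, i ∈ M k) → K.card ≤ N) :
    Summable fun k => ∑ i ∈ M k, f i := by
  classical
  refine summable_of_sum_le (c := N * ∑' i, f i) (fun k => Finset.sum_nonneg fun i _ => hf₀ i)
    fun K => ?_
  have h₁ : ∑ k ∈ K, ∑ i ∈ M k, f i
      = ∑ i ∈ K.biUnion M, ((K.filter fun k => i ∈ M k).card : ℝ) * f i := by
    have : ∀ k ∈ K, ∑ i ∈ M k, f i = ∑ i ∈ K.biUnion M, if i ∈ M k then f i else 0 := by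
      intro k hk
      rw [← Finset.sum_filter]
      congr 1
      ext i
      simp only [Finset.mem_filter, Finset.mem_biUnion]
      exact ⟨fun h => ⟨⟨k, hk, h⟩, h⟩, fun h => h.2⟩
    rw [Finset.sum_congr rfl this, Finset.sum_comm]
    refine Finset.sum_congr rfl fun i _ => ?_
    rw [← Finset.sum_filter, Finset.sum_const, nsmul_eq_mul]
  rw [h₁]
  calc _ ≤ ∑ i ∈ K.biUnion M, (N : ℝ) * f i := by
        refine Finset.sum_le_sum fun i _ => mul_le_mul_of_nonneg_right ?_ (hf₀ i)
        exact_mod_cast hM i _ fun k hk => (Finset.mem_filter.1 hk).2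
    _ = N * ∑ i ∈ K.biUnion M, f i := by rw [Finset.mul_sum]
    _ ≤ _ := mul_le_mul_of_nonneg_left (hf.sum_le_tsum _ fun i _ => hf₀ i) (by positivity)

/-- A convergent series stays convergent after multiplication with suitable factors tending to
infinity. -/
theorem exists_tendsto_summable_mul {f : ℤ → ℝ} (hf₀ : ∀ i, 0 ≤ f i) (hf : Summable f) :
    ∃ h : ℤ → ℝ, (∀ i, 1 ≤ h i) ∧ Tendsto h cofinite atTop ∧ Summable fun i => h i * f i := by
  classical
  -- Outside `s m` the series has mass at most `2 ^ (-m)`, and the factor for `i` will be one plus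
  -- the number of `m` with `i ∉ s m`. Including `[-m, m]` in `s m` makes that number finite.
  have key : ∀ m : ℕ, ∃ s : Finset ℤ, Finset.Icc (-m : ℤ) m ⊆ s ∧
      ∀ t : Finset ℤ, Disjoint t s → ∑ i ∈ t, f i ≤ (1 / 2) ^ m := by
    intro m
    obtain ⟨s, hs⟩ := summable_iff_vanishing_norm.1 hf ((1 / 2) ^ m) (by positivity)
    refine ⟨s ∪ Finset.Icc (-m : ℤ) m, Finset.subset_union_right, fun t ht => ?_⟩
    have := hs t (ht.mono_right Finset.subset_union_left)
    exact (le_abs_self _).trans this.le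
  choose s hs hst using key
  set A : ℤ → Finset ℕ := fun i => (Finset.range i.natAbs).filter fun m => i ∉ s m with hA
  have hmem : ∀ i m, m ∈ A i ↔ i ∉ s m := by
    intro i m
    simp only [hA, Finset.mem_filter, Finset.mem_range, and_iff_right_iff_imp]
    intro h
    by_contra! hm
    exact h (hs m (Finset.mem_Icc.2 ⟨by lia, by lia⟩))
  refine ⟨fun i => 1 + (A i).card, fun i => by simp, ?_, ?_⟩
  · refine tendsto_atTop.2 fun C => ?_
    obtain ⟨M, hM⟩ := exists_nat_gt C
    refine ((Finset.range M).biUnion s).finite_toSet.subset fun i hi => ?_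
    by_contra hni
    refine hi (?_ : C ≤ 1 + ((A i).card : ℝ))
    have : Finset.range M ⊆ A i := fun m hm => by
      rw [hmem]
      intro h
      exact hni (Finset.mem_coe.2 (Finset.mem_biUnion.2 ⟨m, hm, h⟩))
    have := Finset.card_le_card this
    rw [Finset.card_range] at this
    have : (M : ℝ) ≤ (A i).card := by exact_mod_cast this
    linarith
  · have hsum : Summable fun i => ((A i).card : ℝ) * f i := by
      refine summable_of_sum_le (c := 2) (fun i => mul_nonneg (by positivity) (hf₀ i)) fun t => ?_
      have h₁ : ∑ i ∈ t, ((A i).card : ℝ) * f i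
          = ∑ m ∈ t.biUnion A, ∑ i ∈ t.filter (fun i => i ∉ s m), f i := by
        simp_rw [Finset.sum_filter]
        rw [Finset.sum_comm]
        refine Finset.sum_congr rfl fun i hi => ?_
        rw [← Finset.sum_filter, Finset.sum_const, nsmul_eq_mul]
        congr 3
        ext m
        simp only [Finset.mem_filter, Finset.mem_biUnion, ← hmem]
        exact ⟨fun h => ⟨⟨i, hi, h⟩, h⟩, fun h => h.2⟩
      rw [h₁]
      calc _ ≤ ∑ m ∈ t.biUnion A, (1 / 2 : ℝ) ^ m := by
            refine Finset.sum_le_sum fun m _ => hst m _ ?_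
            exact Finset.disjoint_left.2 fun i hi => (Finset.mem_filter.1 hi).2
        _ ≤ ∑' m : ℕ, (1 / 2 : ℝ) ^ m :=
            summable_geometric_two.sum_le_tsum _ fun _ _ => by positivity
        _ = 2 := tsum_geometric_two
    refine (hf.add hsum).congr fun i => by ring

/-- From `m`, the next point is the least `n > m` for which every demand met by `[m, n]` is at most
`n - m`. Since `n - 1` fails, some demand exceeds `n - 1 - m`, which is at least half of `n - m`
once `n ≥ m + 2`; for `n = m + 1` the covering hypothesis supplies the demand. -/
theorem exists_greedy_nat {ι : Type*} (l r q : ι → ℝ) (X : ℕ)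
    (hgrow : ∀ n : ℕ, X ≤ n → ∀ j, l j ≤ n → -(n : ℝ) ≤ r j → q j ≤ n / 2)
    (hcov : ∀ i : ℕ, ∃ j, l j ≤ i + 1 ∧ i ≤ r j ∧ 1 ≤ q j) :
    ∃ u : ℕ → ℕ, u 0 = 0 ∧ ∀ k, u k < u (k + 1) ∧
      (∀ j, l j ≤ u (k + 1) → u k ≤ r j → q j ≤ u (k + 1) - u k) ∧
      ∃ j, l j ≤ u (k + 1) ∧ u k ≤ r j ∧ (u (k + 1) - u k : ℝ) ≤ 2 * q j := by
  classical
  have key : ∀ m : ℕ, ∃ n : ℕ, m < n ∧ (∀ j, l j ≤ n → m ≤ r j → q j ≤ n - m) ∧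
      ∃ j, l j ≤ n ∧ m ≤ r j ∧ (n - m : ℝ) ≤ 2 * q j := by
    intro m
    have hex : ∃ n : ℕ, m < n ∧ ∀ j, l j ≤ n → m ≤ r j → q j ≤ n - m := by
      -- For `n ≥ 2 * m` the growth bound `n / 2` is at most `n - m`.
      refine ⟨X + 2 * m + 1, by lia, fun j h₁ h₂ => ?_⟩
      have := hgrow (X + 2 * m + 1) (by lia) j h₁ (by push_cast; linarith [(Nat.cast_nonneg m : (0 : ℝ) ≤ m), (Nat.cast_nonneg X : (0 : ℝ) ≤ X)])
      have : (0 : ℝ) ≤ X := by positivity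
      push_cast at *
      linarith
    obtain ⟨hlt, hgood⟩ := Nat.find_spec hex
    set n := Nat.find hex with hn
    refine ⟨n, hlt, hgood, ?_⟩
    obtain hn₁ | hn₁ := (Nat.succ_le_of_lt hlt).eq_or_lt
    · obtain ⟨j, h₁, h₂, h₃⟩ := hcov m
      have : (n : ℝ) = m + 1 := by rw [← hn₁]; push_cast; ring
      exact ⟨j, by linarith, h₂, by linarith⟩
    · have hmin := Nat.find_min hex (show n - 1 < Nat.find hex by lia)
      push Not at hmin
      obtain ⟨j, h₁, h₂, h₃⟩ := hmin (by lia)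
      rw [Nat.cast_sub (by lia)] at h₁ h₃
      have : ((m + 2 : ℕ) : ℝ) ≤ n := by exact_mod_cast hn₁
      push_cast at *
      exact ⟨j, by linarith, h₂, by linarith⟩
  choose next h₁ h₂ h₃ using key
  refine ⟨fun k => next^[k] 0, rfl, fun k => ?_⟩
  simp only [Function.iterate_succ_apply']
  exact ⟨h₁ _, h₂ _, h₃ _⟩

theorem exists_greedy_int {ι : Type*} (l r q : ι → ℝ) (X : ℕ)
    (hgrow : ∀ n : ℕ, X ≤ n → ∀ j, l j ≤ n → -(n : ℝ) ≤ r j → q j ≤ n / 2)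
    (hcov : ∀ i : ℤ, ∃ j, l j ≤ i + 1 ∧ i ≤ r j ∧ 1 ≤ q j) :
    ∃ u : ℤ → ℝ, u 0 = 0 ∧ ∀ k, 1 ≤ len u k ∧
      (∀ j, l j ≤ u (k + 1) → u k ≤ r j → q j ≤ len u k) ∧
      ∃ j, l j ≤ u (k + 1) ∧ u k ≤ r j ∧ len u k ≤ 2 * q j := by
  obtain ⟨U, hU₀, hU⟩ := exists_greedy_nat l r q X hgrow fun i => by simpa using hcov i
  obtain ⟨V, hV₀, hV⟩ := exists_greedy_nat (fun j => -r j) (fun j => -l j) q X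
    (fun n hn j h₁ h₂ => hgrow n hn j (by linarith) (by linarith)) fun i => by
      obtain ⟨j, h₁, h₂, h₃⟩ := hcov (-(i + 1))
      push_cast at h₁ h₂
      exact ⟨j, by linarith, by linarith, h₃⟩
  -- The negative half is the greedy choice for the reflected data. The index shift puts `-V 1` at
  -- `-1`, and the halves agree at `0` because `U 0 = V 0 = 0`.
  set u : ℤ → ℝ := fun n => n.rec (fun n => (U n : ℝ)) (fun n => -(V (n + 1) : ℝ)) with hu
  have hneg : ∀ n : ℕ, u (Int.negSucc n + 1) = -(V n : ℝ) := by
    rintro (_ | n)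
    · change u 0 = _
      change (U 0 : ℝ) = _
      simp [hU₀, hV₀]
    · rfl
  refine ⟨u, by change (U 0 : ℝ) = 0; simp [hU₀], ?_⟩
  rintro (n | n)
  · obtain ⟨h₁, h₂, h₃⟩ := hU n
    refine ⟨?_, h₂, h₃⟩
    have : (U n : ℝ) + 1 ≤ U (n + 1) := by exact_mod_cast h₁
    change 1 ≤ (U (n + 1) : ℝ) - U n
    linarith
  · obtain ⟨h₁, h₂, j, h₃⟩ := hV n
    have h₀ : u (Int.negSucc n) = -(V (n + 1) : ℝ) := rfl
    rw [len, hneg, h₀]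
    refine ⟨?_, fun j hj₁ hj₂ => ?_, j, by linarith, by linarith, by linarith⟩
    · have : (V n : ℝ) + 1 ≤ V (n + 1) := by exact_mod_cast h₁
      linarith
    · have := h₂ j (by linarith) (by linarith)
      linarith

end UniformSequences

/-! ### A common short coarsening of two partitions -/

namespace UniformSequences
open Filter Set

/-- If `[l, r]` met two non-adjacent intervals of `u`, the one following the first of them would lie
inside `[l, r]`, yet it must be longer. -/
theorem card_le_two_of_meets {u : ℤ → ℝ} (hu : StrictMono u) {l r : ℝ} (K : Finset ℤ)
    (hK : ∀ k ∈ K, l ≤ u (k + 1) ∧ u k ≤ r ∧ r - l < len u k)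
    (hlen : ∀ k, l ≤ u (k + 1) → u k ≤ r → r - l < len u k) : K.card ≤ 2 := by
  rcases K.eq_empty_or_nonempty with rfl | hne
  · simp
  set k₀ := K.min' hne
  refine (Finset.card_le_card (t := {k₀, k₀ + 1}) fun k hk => ?_).trans Finset.card_le_two
  have hmin : k₀ ≤ k := K.min'_le k hk
  have h₀ := hK k₀ (K.min'_mem hne)
  have h₁ := hK k hk
  by_contra hne
  simp only [Finset.mem_insert, Finset.mem_singleton, not_or] at hne
  have h2 : u (k₀ + 1 + 1) ≤ u k := hu.monotone (by lia)
  have h3 : u (k₀ + 1) < u (k₀ + 1 + 1) := hu (by lia)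
  have := hlen (k₀ + 1) (by linarith) (by linarith)
  rw [len] at this
  linarith

/-- The greedy choice of a short partition all of whose intervals are longer than the demand `q j`
of every interval `[l j, r j]` that meets them. -/
theorem exists_partition_of_demand {ι : Type*} (l r q δ : ι → ℝ)
    (hδ₀ : ∀ j, 0 ≤ δ j) (hlr : ∀ j, l j ≤ r j)
    (hδ : ∀ j y, l j ≤ y → y ≤ r j → δ j ≤ |y|)
    (hq : ∀ j, 1 + (r j - l j) ≤ q j)
    (hcov : ∀ x, ∃ j, l j ≤ x ∧ x ≤ r j)
    (hsum : Summable fun j => q j ^ 2 / (1 + δ j ^ 2)) :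
    ∃ u : ℤ → ℝ, StrictMono u ∧ u 0 = 0 ∧ (∀ k, 1 ≤ len u k) ∧
      (∀ k j, l j ≤ u (k + 1) → u k ≤ r j → q j ≤ len u k) ∧
      Summable fun k => len u k ^ 2 / weight u k := by
  classical
  have hq₁ : ∀ j, 1 ≤ q j := fun j => by linarith [hq j, hlr j]
  -- Summability makes the demands `o(1 + δ j)`. The slope `1/8` serves twice: for the growth bound
  -- `n / 2` of the greedy choice, and to absorb `2 * q j ≤ 2 * B + (1 + δ j) / 4` when weights are
  -- compared.
  have hB : ∃ B ≥ 0, ∀ j, q j ≤ B + (1 + δ j) / 8 := by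
    have hfin : ∀ᶠ j in cofinite, q j ^ 2 / (1 + δ j ^ 2) < (1 / 8) ^ 2 :=
      hsum.tendsto_cofinite_zero.eventually_lt_const (by norm_num)
    obtain ⟨B, hB⟩ := ((Filter.eventually_cofinite.1 hfin).image q).bddAbove
    refine ⟨max B 0, le_max_right _ _, fun j => ?_⟩
    by_cases hj : q j ^ 2 / (1 + δ j ^ 2) < (1 / 8) ^ 2
    · rw [div_lt_iff₀ (by positivity)] at hj
      have h₁ := hδ₀ j
      have : q j ^ 2 ≤ ((1 + δ j) / 8) ^ 2 := by nlinarith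
      have := abs_le_of_sq_le_sq this (by positivity)
      linarith [le_abs_self (q j), le_max_right B 0]
    · have := hB (mem_image_of_mem q hj)
      linarith [hδ₀ j, le_max_left B 0]
  obtain ⟨B, hB₀, hB⟩ := hB
  obtain ⟨X, hX⟩ := exists_nat_gt (4 * B + 1)
  have hmeet : ∀ {j : ι} {s t : ℝ}, s ≤ t → l j ≤ t → s ≤ r j →
      ∃ y, s ≤ y ∧ y ≤ t ∧ l j ≤ y ∧ y ≤ r j := fun {j s t} h₁ h₂ h₃ =>
    ⟨max s (l j), le_max_left _ _, max_le h₁ h₂, le_max_right _ _, max_le h₃ (hlr j)⟩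
  obtain ⟨u, hu₀, hu⟩ := exists_greedy_int l r q X (fun n hn j h₁ h₂ => by
      have : (X : ℝ) ≤ n := by exact_mod_cast hn
      obtain ⟨y, hy₁, hy₂, hy₃, hy₄⟩ := hmeet (by linarith) h₁ h₂
      have := hδ j y hy₃ hy₄
      have := abs_le.2 ⟨hy₁, hy₂⟩
      linarith [hB j]) fun i => by
      obtain ⟨j, h₁, h₂⟩ := hcov i
      exact ⟨j, by linarith, h₂, hq₁ j⟩
  have hmono : StrictMono u := strictMono_int_of_lt_succ fun k => by
    have := (hu k).1; rw [len] at this; linarith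
  refine ⟨u, hmono, hu₀, fun k => (hu k).1, fun k => (hu k).2.1, ?_⟩
  -- Each new interval is charged to a demand of at least half its length. Such a demand is charged
  -- at most twice, so `q ^ 2 / (1 + δ ^ 2)` majorizes the new series.
  choose j hj₁ hj₂ hj₃ using fun k => (hu k).2.2
  have hsum' : Summable fun k => ∑ i ∈ {j k}, q i ^ 2 / (1 + δ i ^ 2) := by
    refine summable_sum_of_multiplicity_le (fun i => by positivity) hsum (fun k => {j k}) 2
      fun i K hK => card_le_two_of_meets hmono (l := l i) (r := r i) K (fun k hk => ?_)
      fun k h₁ h₂ => ?_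
    · obtain rfl := Finset.mem_singleton.1 (hK k hk)
      exact ⟨hj₁ k, hj₂ k, by linarith [(hu k).2.1 _ (hj₁ k) (hj₂ k), hq (j k)]⟩
    · linarith [(hu k).2.1 _ h₁ h₂, hq i]
  simp only [Finset.sum_singleton] at hsum'
  refine Summable.of_nonneg_of_le (fun k => div_nonneg (sq_nonneg _) (weight_pos u k).le)
    (fun k => ?_) (hsum'.mul_left (4 * (2 * (4 * B + 3) ^ 2)))
  obtain ⟨y, hy₁, hy₂, hy₃, hy₄⟩ :=
    hmeet (hmono.monotone (by lia : k ≤ k + 1)) (hj₁ k) (hj₂ k)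
  have h₁ := hδ _ y hy₃ hy₄
  have h₂ := abs_le_infDist_piece_add_len hmono hy₁ hy₂
  have h₃ := hB (j k)
  have h₄ := hj₃ k
  have h₅ := (hu k).1
  have h₆ := hδ₀ (j k)
  have h₇ : 0 ≤ Metric.infDist 0 (piece u k) := Metric.infDist_nonneg
  have hw : 1 + δ (j k) ^ 2 ≤ 2 * (4 * B + 3) ^ 2 * weight u k := by
    rw [weight]
    set D := Metric.infDist 0 (piece u k)
    have : 1 + δ (j k) ≤ (4 * B + 3) * (1 + D) := by nlinarith
    have h8 : (1 + δ (j k)) ^ 2 ≤ ((4 * B + 3) * (1 + D)) ^ 2 := by gcongr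
    have h9 : (1 + D) ^ 2 ≤ 2 * (1 + D ^ 2) := by nlinarith [sq_nonneg (1 - D)]
    calc 1 + δ (j k) ^ 2 ≤ (1 + δ (j k)) ^ 2 := by nlinarith
      _ ≤ (4 * B + 3) ^ 2 * (1 + D) ^ 2 := by rw [← mul_pow]; exact h8
      _ ≤ (4 * B + 3) ^ 2 * (2 * (1 + D ^ 2)) := by gcongr
      _ = _ := by ring
  have hwp := weight_pos u k
  rw [← mul_div_assoc, div_le_div_iff₀ hwp (by positivity)]
  calc len u k ^ 2 * (1 + δ (j k) ^ 2)
      ≤ (2 * q (j k)) ^ 2 * (2 * (4 * B + 3) ^ 2 * weight u k) := by gcongr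
    _ = _ := by ring

/-- With factors `h i → ∞` that preserve convergence of the shortness series, `1 + √(h i) * len a i`
is still square summable against the weights but much larger than `len a i`. -/
theorem exists_demand {a : ℤ → ℝ} (ha : IsShortPartition a) :
    ∃ q : ℤ → ℝ, (∀ i, 1 + len a i ≤ q i) ∧ (Summable fun i => q i ^ 2 / weight a i) ∧
      ∀ η > 0, ∀ᶠ i in cofinite, len a i ≤ η * q i := by
  obtain ⟨h, h₁, h₂, h₃⟩ := exists_tendsto_summable_mul
    (fun i => div_nonneg (sq_nonneg (len a i)) (weight_pos a i).le) ha.short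
  have hl := len_pos ha.strictMono
  refine ⟨fun i => 1 + √(h i) * len a i, fun i => ?_, ?_, fun η hη => ?_⟩
  · have : 1 ≤ √(h i) := Real.one_le_sqrt.2 (h₁ i)
    nlinarith [hl i]
  · refine Summable.of_nonneg_of_le (fun i => div_nonneg (sq_nonneg _) (weight_pos a i).le)
      (fun i => ?_) ((ha.summable_const_div_weight.add h₃).mul_left 2)
    rw [← mul_div_assoc, ← add_div, ← mul_div_assoc]
    have hs : √(h i) ^ 2 = h i := Real.sq_sqrt (by linarith [h₁ i])
    have := weight_pos a i
    gcongr
    rw [← hs]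
    nlinarith [sq_nonneg (1 - √(h i) * len a i)]
  · filter_upwards [h₂.eventually_ge_atTop ((1 / η) ^ 2)] with i hi
    have : 1 / η ≤ √(h i) := Real.le_sqrt_of_sq_le hi
    have : 1 ≤ η * √(h i) := by rw [div_le_iff₀ hη] at this; linarith
    nlinarith [hl i]

/-- Every interval of `u` is longer than the intervals of `a` that meet it, and eventually much
longer. -/
structure IsCoarsening (a u : ℤ → ℝ) : Prop where
  len_lt : ∀ k i, a i ≤ u (k + 1) → u k ≤ a (i + 1) → len a i < len u k
  len_le : ∀ η > 0, ∀ᶠ k in cofinite, ∀ i, a i ≤ u (k + 1) → u k ≤ a (i + 1) →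
    len a i ≤ η * len u k

/-- Each old interval meets at most two new ones, so finitely many bad `i` spoil only finitely many
`k`. -/
theorem eventually_forall_meets {a u : ℤ → ℝ} (hu : StrictMono u)
    (h : ∀ k i, a i ≤ u (k + 1) → u k ≤ a (i + 1) → len a i < len u k) {p : ℤ → Prop}
    (hp : ∀ᶠ i in cofinite, p i) :
    ∀ᶠ k in cofinite, ∀ i, a i ≤ u (k + 1) → u k ≤ a (i + 1) → p i := by
  have hfin : ∀ i, {k | a i ≤ u (k + 1) ∧ u k ≤ a (i + 1)}.Finite := by
    intro i
    by_contra hinf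
    obtain ⟨K, hK, hc⟩ := Set.Infinite.exists_subset_card_eq hinf 3
    have := card_le_two_of_meets hu (l := a i) (r := a (i + 1)) K
      (fun k hk => ⟨(hK hk).1, (hK hk).2, h k i (hK hk).1 (hK hk).2⟩) fun k h₁ h₂ => h k i h₁ h₂
    lia
  refine ((Filter.eventually_cofinite.1 hp).biUnion fun i _ => hfin i).subset fun k hk => ?_
  simp only [mem_compl_iff, mem_ofPred_eq, not_forall] at hk
  obtain ⟨i, h₁, h₂, h₃⟩ := hk
  simp only [mem_iUnion]
  exact ⟨i, h₃, h₁, h₂⟩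

theorem IsCoarsening.of_demand {a u q : ℤ → ℝ} (hu : StrictMono u)
    (hq : ∀ i, 1 + len a i ≤ q i)
    (hη : ∀ η > 0, ∀ᶠ i in cofinite, len a i ≤ η * q i)
    (hdem : ∀ k i, a i ≤ u (k + 1) → u k ≤ a (i + 1) → q i ≤ len u k) : IsCoarsening a u := by
  have h : ∀ k i, a i ≤ u (k + 1) → u k ≤ a (i + 1) → len a i < len u k := fun k i h₁ h₂ => by
    linarith [hdem k i h₁ h₂, hq i]
  refine ⟨h, fun η hη₀ => ?_⟩
  filter_upwards [eventually_forall_meets hu h (hη η hη₀)] with k hk i h₁ h₂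
  have := hdem k i h₁ h₂
  exact (hk i h₁ h₂).trans (by gcongr)

theorem tendsto_len_of_isCoarsening {a u : ℤ → ℝ} (ha : IsShortPartition a)
    (hu : ∀ k, 1 ≤ len u k) (h : IsCoarsening a u) : Tendsto (len u) cofinite atTop := by
  obtain ⟨m, hm, hlen⟩ := ha.exists_le_len
  refine tendsto_atTop.2 fun C => ?_
  filter_upwards [h.len_le (m / (|C| + 1)) (by positivity)] with k hk
  obtain ⟨i, hi⟩ := ha.exists_mem_piece (u k)
  have h₁ := hk i (by have := hi.1; have := hu k; rw [len] at this; linarith) hi.2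
  have h₂ := hlen i
  have hC : 0 < |C| + 1 := by positivity
  rw [div_mul_eq_mul_div, le_div_iff₀ hC] at h₁
  have : m * (|C| + 1) ≤ m * len u k := by nlinarith
  have := le_of_mul_le_mul_left this hm
  linarith [le_abs_self C]

/-- Two short partitions have a common coarsening that is short. -/
theorem exists_common_coarsening {a b : ℤ → ℝ} (ha : IsShortPartition a)
    (hb : IsShortPartition b) : ∃ u : ℤ → ℝ, IsShortPartition u ∧ (∀ k, 1 ≤ len u k) ∧
      IsCoarsening a u ∧ IsCoarsening b u := by
  obtain ⟨p, hp₁, hp₂, hp₃⟩ := exists_demand ha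
  obtain ⟨q, hq₁, hq₂, hq₃⟩ := exists_demand hb
  obtain ⟨u, hu, hu₀, hu₁, hdem, hsum⟩ := exists_partition_of_demand (ι := ℤ ⊕ ℤ)
    (Sum.elim a b) (Sum.elim (fun i => a (i + 1)) fun i => b (i + 1)) (Sum.elim p q)
    (Sum.elim (fun i => Metric.infDist 0 (piece a i)) fun i => Metric.infDist 0 (piece b i))
    (by rintro (i | i) <;> exact Metric.infDist_nonneg)
    (by
      rintro (i | i)
      · exact ha.strictMono.monotone (by lia)
      · exact hb.strictMono.monotone (by lia))
    (by
      rintro (i | i) y h₁ h₂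
      · exact infDist_piece_le ha.strictMono h₁ h₂
      · exact infDist_piece_le hb.strictMono h₁ h₂)
    (by rintro (i | i); exacts [hp₁ i, hq₁ i])
    (fun x => by
      obtain ⟨i, hi⟩ := ha.exists_mem_piece x
      exact ⟨Sum.inl i, hi.1.le, hi.2⟩)
    (Summable.sum _ hp₂ hq₂)
  have hca : IsCoarsening a u := .of_demand hu hp₁ hp₃ fun k i => hdem k (Sum.inl i)
  have hcb : IsCoarsening b u := .of_demand hu hq₁ hq₃ fun k i => hdem k (Sum.inr i)
  refine ⟨u, ⟨hu, hu₀, ?_, hsum⟩, hu₁, hca, hcb⟩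
  rw [← Int.cofinite_eq]
  exact tendsto_len_of_isCoarsening ha hu₁ hca

end UniformSequences

/-! ### Logarithmic energy through overlapping dyadic cells -/

namespace UniformSequences
open Filter Set

/-- The overlapping dyadic cells of `(u, u + R]`: the cell `⟨j, k⟩` has length `2 * R / 2 ^ j`. -/
def cell (u R : ℝ) (c : Σ _ : ℕ, ℕ) : Set ℝ :=
  Ico (u + c.2 * (R / 2 ^ c.1)) (u + (c.2 + 2) * (R / 2 ^ c.1))

/-- The indices of the cells of the first `J` generations. -/
def cells (J : ℕ) : Finset (Σ _ : ℕ, ℕ) :=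
  (Finset.range J).sigma fun j => Finset.range (2 ^ j + 1)

open Classical in
-- Cells of generation `j` start every `R / 2 ^ j` and are twice as long, so points at distance at
-- most `R / 2 ^ j` share one. This happens for all `j ≤ n`, where `2 ^ n ≤ R / |x - y| < 2 ^ (n +
-- 1)`.
theorem log_div_le_card_cells {u R x y : ℝ} (hR : 0 < R) {J : ℕ} (hx : x ∈ Ioc u (u + R))
    (hy : y ∈ Ioc u (u + R)) (hne : x ≠ y) (hJ : R / 2 ^ J < |x - y|) :
    Real.log (R / |x - y|) ≤
      ((cells J).filter fun c => x ∈ cell u R c ∧ y ∈ cell u R c).card := by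
  wlog hxy : x < y generalizing x y
  · rw [abs_sub_comm]
    have := this hy hx hne.symm (by rwa [abs_sub_comm]) (hne.lt_or_gt.resolve_left hxy)
    simpa only [and_comm] using this
  have hs : |x - y| = y - x := by rw [abs_sub_comm, abs_of_pos (by linarith)]
  have hsp : 0 < y - x := by linarith
  rw [hs] at hJ ⊢
  obtain ⟨n, hn₁, hn₂⟩ := exists_nat_pow_near (x := R / (y - x)) (y := (2 : ℝ))
    (by rw [le_div_iff₀ hsp]; linarith [hx.1, hy.2]) one_lt_two
  have hnJ : n < J := by
    rw [div_lt_iff₀ (by positivity), mul_comm, ← div_lt_iff₀ hsp] at hJ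
    exact (pow_lt_pow_iff_right₀ one_lt_two).1 (hn₁.trans_lt hJ)
  have hcard : n + 1 ≤ ((cells J).filter fun c => x ∈ cell u R c ∧ y ∈ cell u R c).card := by
    rw [← Finset.card_range (n + 1)]
    refine Finset.card_le_card_of_injOn (fun j => ⟨j, ⌊(x - u) / (R / 2 ^ j)⌋₊⟩) (fun j hj => ?_)
      fun i _ j _ h => congrArg Sigma.fst h
    have hjn : j ≤ n := by simpa [Nat.lt_succ_iff] using hj
    have hr : 0 < R / 2 ^ j := by positivity
    simp only [Finset.coe_filter, mem_ofPred_eq, cells, Finset.mem_sigma, Finset.mem_range, cell,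
      mem_Ico]
    set t := (x - u) / (R / 2 ^ j) with ht
    have hxt : x = u + t * (R / 2 ^ j) := by rw [ht]; field_simp; ring
    have ht₀ : 0 ≤ t := div_nonneg (by linarith [hx.1]) hr.le
    have hf₁ := Nat.floor_le ht₀
    have hf₂ := Nat.lt_floor_add_one t
    have hyx : y - x ≤ R / 2 ^ j := by
      have : (2 : ℝ) ^ j ≤ R / (y - x) :=
        (pow_le_pow_right₀ one_le_two hjn).trans hn₁
      rw [le_div_iff₀ hsp] at this
      rw [le_div_iff₀ (by positivity)]
      linarith
    -- Equality occurs at the right endpoint `x = u + R`; this is why each generation has `2 ^ j +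
    -- 1` cells.
    have ht₁ : t ≤ 2 ^ j := by
      rw [ht, div_div_eq_mul_div, div_le_iff₀ hR]
      nlinarith [hx.2, pow_pos (two_pos : (0 : ℝ) < 2) j]
    refine ⟨⟨by lia, ?_⟩, ⟨?_, ?_⟩, ?_, ?_⟩
    · rw [Nat.lt_succ_iff]
      exact Nat.floor_le_of_le (by push_cast; exact ht₁)
    · rw [hxt]; gcongr
    · rw [hxt]; gcongr; linarith
    · have : (⌊t⌋₊ : ℝ) * (R / 2 ^ j) ≤ t * (R / 2 ^ j) := by gcongr
      linarith
    · have : t * (R / 2 ^ j) < (⌊t⌋₊ + 1 : ℝ) * (R / 2 ^ j) := by gcongr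
      linarith
  have hlog2 := Real.log_two_lt_d9
  have hlog2' : 0 < Real.log 2 := Real.log_pos one_lt_two
  calc Real.log (R / (y - x)) ≤ Real.log (2 ^ (n + 1)) :=
        Real.log_le_log (by positivity) hn₂.le
    _ = (n + 1 : ℕ) * Real.log 2 := by rw [Real.log_pow]
    _ ≤ (n + 1 : ℕ) * 1 := by gcongr; linarith
    _ ≤ _ := by rw [mul_one]; exact_mod_cast hcard

open Classical in
-- A point lies in at most two cells of each generation, and only generations with `2 ^ j < 2 * R /
-- s` have cells longer than `s`.
theorem card_cells_le {u R x s : ℝ} (hR : 0 < R) (hs : 0 < s) (hsR : s ≤ R) (J : ℕ) :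
    (((cells J).filter fun c => x ∈ cell u R c ∧ s < 2 * (R / 2 ^ c.1)).card : ℝ) ≤
      4 * (Real.log (R / s) + 2) := by
  obtain ⟨n, hn₁, hn₂⟩ := exists_nat_pow_near (x := 2 * R / s) (y := (2 : ℝ))
    (by rw [le_div_iff₀ hs]; linarith) one_lt_two
  have hsub : ((cells J).filter fun c => x ∈ cell u R c ∧ s < 2 * (R / 2 ^ c.1)) ⊆
      (Finset.range (n + 1)).sigma fun j =>
        Finset.Icc (⌊(x - u) / (R / 2 ^ j)⌋₊ - 1) ⌊(x - u) / (R / 2 ^ j)⌋₊ := by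
    rintro ⟨j, k⟩ hc
    simp only [Finset.mem_filter, cell, mem_Ico] at hc
    obtain ⟨-, ⟨h₁, h₂⟩, h₃⟩ := hc
    have hr : 0 < R / 2 ^ j := by positivity
    simp only [Finset.mem_sigma, Finset.mem_range, Finset.mem_Icc]
    have ht₁ : (k : ℝ) ≤ (x - u) / (R / 2 ^ j) := by rw [le_div_iff₀ hr]; linarith
    have ht₂ : (x - u) / (R / 2 ^ j) < ((k + 2 : ℕ) : ℝ) := by
      rw [div_lt_iff₀ hr]; push_cast; linarith
    refine ⟨?_, ?_, Nat.le_floor ht₁⟩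
    · have : (2 : ℝ) ^ j < 2 ^ (n + 1) := by
        refine lt_of_lt_of_le ?_ hn₂.le
        rw [lt_div_iff₀ hs]
        rw [← mul_div_assoc, lt_div_iff₀ (by positivity)] at h₃
        linarith
      exact (pow_lt_pow_iff_right₀ one_lt_two).1 this
    · have := (Nat.floor_lt ((Nat.cast_nonneg k).trans ht₁)).2 ht₂
      lia
  have hcard := Finset.card_le_card hsub
  rw [Finset.card_sigma] at hcard
  have h2 : ∑ j ∈ Finset.range (n + 1),
      (Finset.Icc (⌊(x - u) / (R / 2 ^ j)⌋₊ - 1) ⌊(x - u) / (R / 2 ^ j)⌋₊).card ≤ (n + 1) * 2 := by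
    refine (Finset.sum_le_card_nsmul _ _ 2 fun j _ => ?_).trans (by simp)
    rw [Nat.card_Icc]; lia
  have h3 : (((cells J).filter fun c => x ∈ cell u R c ∧ s < 2 * (R / 2 ^ c.1)).card : ℝ) ≤
      (n + 1) * 2 := by exact_mod_cast hcard.trans h2
  have h4 : n * Real.log 2 ≤ Real.log 2 + Real.log (R / s) := by
    rw [← Real.log_pow, ← Real.log_mul (by norm_num) (by positivity)]
    exact Real.log_le_log (by positivity) (by rwa [← mul_div_assoc])
  have h5 := Real.log_two_gt_d9
  have h6 := Real.log_two_lt_d9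
  have h7 : 0 ≤ Real.log (R / s) := Real.log_nonneg ((one_le_div hs).2 hsR)
  have h8 : (n : ℝ) ≤ 1 + 2 * Real.log (R / s) := by
    by_contra! h
    nlinarith
  linarith

theorem sum_cells_sq_le {R : ℝ} (J : ℕ) :
    ∑ c ∈ cells J, (2 * (R / 2 ^ c.1)) ^ 2 ≤ 16 * R ^ 2 := by
  rw [cells, Finset.sum_sigma]
  calc ∑ j ∈ Finset.range J, ∑ k ∈ Finset.range (2 ^ j + 1), (2 * (R / 2 ^ j)) ^ 2
      ≤ ∑ j ∈ Finset.range J, 8 * R ^ 2 * (1 / 2) ^ j := by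
        refine Finset.sum_le_sum fun j _ => ?_
        rw [Finset.sum_const, Finset.card_range, nsmul_eq_mul]
        push_cast
        have h1 : (1 : ℝ) ≤ 2 ^ j := one_le_pow₀ one_le_two
        have h2 : (0 : ℝ) ≤ R ^ 2 / (2 ^ j) ^ 2 := by positivity
        calc ((2 : ℝ) ^ j + 1) * (2 * (R / 2 ^ j)) ^ 2 = (2 ^ j + 1) * 4 * (R ^ 2 / (2 ^ j) ^ 2) := by
              ring
          _ ≤ (2 * 2 ^ j) * 4 * (R ^ 2 / (2 ^ j) ^ 2) := by gcongr; linarith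
          _ = _ := by rw [one_div, inv_pow]; field_simp; ring
    _ = 8 * R ^ 2 * ∑ j ∈ Finset.range J, (1 / 2 : ℝ) ^ j := by rw [Finset.mul_sum]
    _ ≤ 8 * R ^ 2 * 2 := by
        gcongr
        have := summable_geometric_two.sum_le_tsum (Finset.range J) fun _ _ => by positivity
        rwa [tsum_geometric_two] at this
    _ = _ := by ring

theorem sum_card_filter_comm {α β : Type*} (S : Finset α) (T : Finset β) (Q : α → β → Prop)
    [∀ x y, Decidable (Q x y)] : ∑ y ∈ T, ((S.filter fun x => Q x y).card : ℝ) =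
      ∑ x ∈ S, ((T.filter fun y => Q x y).card : ℝ) := by
  simp only [Finset.card_filter, Nat.cast_sum]
  exact Finset.sum_comm

open Classical in
/-- If the pairs in `P` are dominated on every interval by the area, by the pairs of the sets
`F i` and by the points `pos x` seen at scale `σ x`, then so is the energy of `P`. -/
theorem sum_log_div_le {ι κ : Type*} {u R : ℝ} (hR : 0 < R) (P : Finset (ℝ × ℝ))
    (hP : ∀ p ∈ P, p.1 ∈ Ioc u (u + R) ∧ p.2 ∈ Ioc u (u + R) ∧ p.1 ≠ p.2)
    (M : Finset ι) (F : ι → Finset ℝ) (hF : ∀ i ∈ M, ∀ p ∈ (F i).offDiag, |p.1 - p.2| ≤ R)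
    (X : Finset κ) (pos σ : κ → ℝ) (hσ : ∀ x ∈ X, 0 < σ x ∧ σ x ≤ R) {A B : ℝ}
    (hA : 0 ≤ A) (hB : 0 ≤ B)
    (hcell : ∀ s t, s < t → ((P.filter fun p => p.1 ∈ Ico s t ∧ p.2 ∈ Ico s t).card : ℝ) ≤
      A * (t - s) ^ 2 +
      B * ∑ i ∈ M, (((F i).offDiag.filter fun p => p.1 ∈ Ico s t ∧ p.2 ∈ Ico s t).card : ℝ) +
      B * ((X.filter fun x => pos x ∈ Ico s t ∧ σ x < t - s).card : ℝ)) :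
    ∑ p ∈ P, Real.log (R / |p.1 - p.2|) ≤ 16 * A * R ^ 2 +
      4 * B * ∑ i ∈ M, ∑ p ∈ (F i).offDiag, (Real.log (R / |p.1 - p.2|) + 2) +
      4 * B * ∑ x ∈ X, (Real.log (R / σ x) + 2) := by
  -- Finitely many generations suffice: `R / 2 ^ J` is below the smallest gap in `P`.
  obtain ⟨J, hJ⟩ : ∃ J : ℕ, ∀ p ∈ P, R / 2 ^ J < |p.1 - p.2| := by
    have : ∀ᶠ J : ℕ in atTop, ∀ p ∈ P, R / 2 ^ J < |p.1 - p.2| := by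
      rw [Filter.eventually_all_finset]
      intro p hp
      have hpos : 0 < |p.1 - p.2| := abs_pos.2 (sub_ne_zero.2 (hP p hp).2.2)
      have ht : Tendsto (fun J : ℕ => R * (1 / 2 : ℝ) ^ J) atTop (nhds (R * 0)) :=
        (tendsto_pow_atTop_nhds_zero_of_lt_one (by norm_num) (by norm_num)).const_mul R
      rw [mul_zero] at ht
      filter_upwards [ht.eventually_lt_const hpos] with J hJ
      rwa [one_div, inv_pow, ← div_eq_mul_inv] at hJ
    exact this.exists
  have hlen : ∀ c : Σ _ : ℕ, ℕ,
      (u + (c.2 + 2) * (R / 2 ^ c.1)) - (u + c.2 * (R / 2 ^ c.1)) = 2 * (R / 2 ^ c.1) :=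
    fun c => by ring
  have hr : ∀ c : Σ _ : ℕ, ℕ, 0 < R / 2 ^ c.1 := fun c => by positivity
  have h₁ : ∑ p ∈ P, Real.log (R / |p.1 - p.2|) ≤
      ∑ c ∈ cells J, ((P.filter fun p => p.1 ∈ cell u R c ∧ p.2 ∈ cell u R c).card : ℝ) := by
    rw [sum_card_filter_comm P (cells J) fun p c => p.1 ∈ cell u R c ∧ p.2 ∈ cell u R c]
    exact Finset.sum_le_sum fun p hp =>
      log_div_le_card_cells hR (hP p hp).1 (hP p hp).2.1 (hP p hp).2.2 (hJ p hp)
  have h₂ : ∀ c, ((P.filter fun p => p.1 ∈ cell u R c ∧ p.2 ∈ cell u R c).card : ℝ) ≤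
      A * (2 * (R / 2 ^ c.1)) ^ 2 + B * ∑ i ∈ M, (((F i).offDiag.filter
        fun p => p.1 ∈ cell u R c ∧ p.2 ∈ cell u R c).card : ℝ) +
      B * ((X.filter fun x => pos x ∈ cell u R c ∧ σ x < 2 * (R / 2 ^ c.1)).card : ℝ) := by
    intro c
    have := hcell (u + c.2 * (R / 2 ^ c.1)) (u + (c.2 + 2) * (R / 2 ^ c.1))
      (by linarith [hlen c, hr c])
    rw [hlen] at this
    convert this <;> rfl
  -- Two points of one cell are closer than its length, so the cells containing a pair are among
  -- those containing its first point and longer than the gap.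
  have h₃ : ∀ i ∈ M, ∑ c ∈ cells J, (((F i).offDiag.filter
      fun p => p.1 ∈ cell u R c ∧ p.2 ∈ cell u R c).card : ℝ) ≤
      ∑ p ∈ (F i).offDiag, 4 * (Real.log (R / |p.1 - p.2|) + 2) := by
    intro i hi
    rw [sum_card_filter_comm (F i).offDiag (cells J) fun p c => p.1 ∈ cell u R c ∧ p.2 ∈ cell u R c]
    refine Finset.sum_le_sum fun p hp => ?_
    have hne : p.1 ≠ p.2 := (Finset.mem_offDiag.1 hp).2.2
    refine le_trans ?_ (card_cells_le (u := u) (x := p.1) hR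
      (abs_pos.2 (sub_ne_zero.2 hne)) (hF i hi p hp) J)
    rw [Nat.cast_le]
    refine Finset.card_le_card (Finset.monotone_filter_right _ fun c _ hc => ⟨hc.1, ?_⟩)
    rw [← hlen c, abs_lt]
    constructor <;> linarith [hc.1.1, hc.1.2, hc.2.1, hc.2.2]
  have h₄ : ∑ c ∈ cells J,
      ((X.filter fun x => pos x ∈ cell u R c ∧ σ x < 2 * (R / 2 ^ c.1)).card : ℝ) ≤
      ∑ x ∈ X, 4 * (Real.log (R / σ x) + 2) := by
    rw [sum_card_filter_comm X (cells J) fun x c => pos x ∈ cell u R c ∧ σ x < 2 * (R / 2 ^ c.1)]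
    exact Finset.sum_le_sum fun x hx => card_cells_le hR (hσ x hx).1 (hσ x hx).2 J
  refine h₁.trans ((Finset.sum_le_sum fun c _ => h₂ c).trans ?_)
  rw [Finset.sum_add_distrib, Finset.sum_add_distrib, ← Finset.mul_sum, ← Finset.mul_sum,
    ← Finset.mul_sum, Finset.sum_comm]
  have h₅ := mul_le_mul_of_nonneg_left (sum_cells_sq_le (R := R) J) hA
  have h₆ := mul_le_mul_of_nonneg_left (Finset.sum_le_sum h₃) hB
  have h₇ := mul_le_mul_of_nonneg_left h₄ hB
  simp only [← Finset.mul_sum] at h₆ h₇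
  linarith

end UniformSequences

/-! ### Excess energy and pair counts after deleting last points -/

namespace UniformSequences
open Filter Set

/-- The energy of a finite set at scale `R`, over ordered pairs of distinct points. -/
noncomputable def excess (R : ℝ) (F : Finset ℝ) : ℝ :=
  ∑ p ∈ F.offDiag, Real.log (R / |p.1 - p.2|)

/-- The points of `L` that are not the last point of `L` in their interval of `a`. -/
def dropLast (L : Set ℝ) (a : ℤ → ℝ) : Set ℝ :=
  {x | x ∈ L ∧ ∃ y ∈ L, x < y ∧ ∃ i, x ∈ piece a i ∧ y ∈ piece a i}

theorem abs_sub_le_len {a : ℤ → ℝ} {n : ℤ} {x y : ℝ} (hx : x ∈ piece a n) (hy : y ∈ piece a n) :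
    |x - y| ≤ len a n := by
  rw [abs_le, len]; constructor <;> linarith [hx.1, hx.2, hy.1, hy.2]

theorem excess_nonneg {a : ℤ → ℝ} {n : ℤ} {F : Finset ℝ} (hF : ∀ x ∈ F, x ∈ piece a n) :
    0 ≤ excess (len a n) F :=
  Finset.sum_nonneg fun p hp => by
    obtain ⟨h₁, h₂, h₃⟩ := Finset.mem_offDiag.1 hp
    exact Real.log_nonneg
      ((one_le_div (abs_pos.2 (sub_ne_zero.2 h₃))).2 (abs_sub_le_len (hF _ h₁) (hF _ h₂)))

theorem exists_finset_eq {L : Set ℝ} (hL : ∀ x : ℝ, ¬ AccPt x (𝓟 L)) (a : ℤ → ℝ) :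
    ∃ F : ℤ → Finset ℝ, ∀ n, (F n : Set ℝ) = L ∩ piece a n :=
  ⟨fun n => (finite_inter_Ioc hL (a n) (a (n + 1))).toFinset, fun n => by simp [piece]⟩

theorem cast_card_offDiag (F : Finset ℝ) :
    (F.offDiag.card : ℝ) = F.card * (F.card - 1) := by
  rw [Finset.offDiag_card, Nat.cast_sub (Nat.le_mul_self _)]
  push_cast; ring

theorem excess_eq {R : ℝ} (hR : 0 < R) (F : Finset ℝ) :
    excess R F = F.card * (F.card - 1) * Real.log R - logEnergy F := by
  rw [logEnergy, ← Finset.coe_offDiag, finsum_mem_coe_finset, excess, ← cast_card_offDiag,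
    ← nsmul_eq_mul, ← Finset.sum_const, ← Finset.sum_sub_distrib]
  refine Finset.sum_congr rfl fun p hp => ?_
  have := (Finset.mem_offDiag.1 hp).2.2
  exact Real.log_div hR.ne' (abs_pos.2 (sub_ne_zero.2 this)).ne'

theorem count_eq_card {L : Set ℝ} {a : ℤ → ℝ} {n : ℤ} {F : Finset ℝ}
    (hF : (F : Set ℝ) = L ∩ piece a n) : count L a n = F.card := by
  rw [count, ← hF, Set.ncard_coe_finset]

/-- There are `Δ(Δ - 1)` ordered pairs rather than `Δ ^ 2`. The difference `Δ log |S|` is `O(|S| ^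
2)` and hence summable by shortness. The excess form has nonnegative terms. -/
theorem energyCondition_iff {L : Set ℝ} {a : ℤ → ℝ} (ha : IsShortPartition a) {D : ℝ}
    (hD : ∀ n, count L a n ≤ D * len a n) {F : ℤ → Finset ℝ}
    (hF : ∀ n, (F n : Set ℝ) = L ∩ piece a n) :
    EnergyCondition L a ↔ Summable fun n => excess (len a n) (F n) / weight a n := by
  obtain ⟨m, hm, hlen⟩ := ha.exists_le_len
  have hlin : Summable fun n => count L a n * Real.log (len a n) / weight a n := by
    refine Summable.of_norm_bounded (ha.short.mul_left (D * (1 + 1 / m ^ 2))) fun n => ?_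
    have hw := weight_pos a n
    have hl := len_pos ha.strictMono n
    have hc : 0 ≤ count L a n := Nat.cast_nonneg _
    rw [Real.norm_eq_abs, abs_div, abs_of_pos hw, abs_mul, abs_of_nonneg hc, ← mul_div_assoc]
    refine div_le_div_of_nonneg_right ?_ hw.le
    have h₁ : |Real.log (len a n)| ≤ (1 + 1 / m ^ 2) * len a n := by
      have h₂ := Real.log_le_sub_one_of_pos hl
      have h₃ := Real.log_le_sub_one_of_pos (inv_pos.2 hl)
      rw [Real.log_inv] at h₃
      have h₄ : (len a n)⁻¹ ≤ 1 / m ^ 2 * len a n := by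
        rw [inv_eq_one_div, div_mul_eq_mul_div, one_mul, div_le_div_iff₀ hl (by positivity)]
        nlinarith [hlen n]
      have h₅ : 0 ≤ 1 / m ^ 2 * len a n := by positivity
      have h₆ : 0 ≤ (len a n)⁻¹ := by positivity
      rw [abs_le]; constructor <;> linarith
    calc count L a n * |Real.log (len a n)|
        ≤ (D * len a n) * ((1 + 1 / m ^ 2) * len a n) :=
          mul_le_mul (hD n) h₁ (abs_nonneg _) (hc.trans (hD n))
      _ = _ := by ring
  have key : ∀ n, (count L a n ^ 2 * Real.log (len a n) - logEnergy (L ∩ piece a n)) / weight a n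
      = count L a n * Real.log (len a n) / weight a n + excess (len a n) (F n) / weight a n := by
    intro n
    rw [excess_eq (len_pos ha.strictMono n), count_eq_card (hF n), hF n, ← add_div]
    ring
  rw [EnergyCondition, funext key]
  exact ⟨fun h => by simpa using h.sub hlin, fun h => hlin.add h⟩

theorem cast_card_offDiag_filter (F : Finset ℝ) (Q : Set ℝ) [DecidablePred (· ∈ Q)] :
    ((F.offDiag.filter fun p => p.1 ∈ Q ∧ p.2 ∈ Q).card : ℝ) =
      (F.filter (· ∈ Q)).card * ((F.filter (· ∈ Q)).card - 1) := by
  rw [← cast_card_offDiag]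
  congr 2
  ext p
  simp only [Finset.mem_filter, Finset.mem_offDiag]
  tauto

open Classical in
-- Only the leftmost and rightmost old intervals holding points of the window need care, since those
-- between lie inside the window and have at most `D * (t - s)` points. The deleted point of the
-- leftmost one is in the window too, so a single kept point there already comes with a pair of
-- original points, which pays for the pairs across.
theorem card_offDiag_dropLast_le {L : Set ℝ} {a : ℤ → ℝ} (ha : StrictMono a)
    (hL : ∀ x : ℝ, ¬ AccPt x (𝓟 L)) {D : ℝ} (hD₀ : 0 ≤ D) (hD : ∀ n, count L a n ≤ D * len a n)
    {F : ℤ → Finset ℝ} (hF : ∀ n, (F n : Set ℝ) = L ∩ piece a n) (F' : Finset ℝ)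
    (hF' : ∀ x ∈ F', x ∈ dropLast L a) (M : Finset ℤ) (hM : ∀ x ∈ F', ∃ i ∈ M, x ∈ piece a i)
    {s t : ℝ} (hst : s < t) :
    ((F'.offDiag.filter fun p => p.1 ∈ Ico s t ∧ p.2 ∈ Ico s t).card : ℝ) ≤
      6 * D ^ 2 * (t - s) ^ 2 +
      6 * ∑ i ∈ M, (((F i).offDiag.filter fun p => p.1 ∈ Ico s t ∧ p.2 ∈ Ico s t).card : ℝ) := by
  have hmem : ∀ {n x}, x ∈ F n ↔ x ∈ L ∧ x ∈ piece a n := fun {n x} => by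
    rw [← Finset.mem_coe, hF]; rfl
  have hsq : 0 ≤ 6 * D ^ 2 * (t - s) ^ 2 := by positivity
  set S := ∑ i ∈ M, (((F i).offDiag.filter fun p => p.1 ∈ Ico s t ∧ p.2 ∈ Ico s t).card : ℝ)
    with hS
  have hS₀ : 0 ≤ S := Finset.sum_nonneg fun _ _ => Nat.cast_nonneg _
  set G := F'.filter (· ∈ Ico s t) with hG
  have hGmem : ∀ {x}, x ∈ G → x ∈ F' ∧ x ∈ Ico s t := fun {x} h => Finset.mem_filter.1 h
  have hcard : ((F'.offDiag.filter fun p => p.1 ∈ Ico s t ∧ p.2 ∈ Ico s t).card : ℝ) =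
      G.card * (G.card - 1) := by
    rw [hG, ← cast_card_offDiag_filter]
  have hcardF : ∀ i, (((F i).offDiag.filter fun p => p.1 ∈ Ico s t ∧ p.2 ∈ Ico s t).card : ℝ) =
      ((F i).filter (· ∈ Ico s t)).card * (((F i).filter (· ∈ Ico s t)).card - 1) := by
    intro i
    rw [← cast_card_offDiag_filter]
  rw [hcard]
  rcases G.eq_empty_or_nonempty with hempty | hne
  · rw [hempty, Finset.card_empty, Nat.cast_zero, zero_mul]
    linarith
  have hG₁ : (1 : ℝ) ≤ G.card := by exact_mod_cast hne.card_pos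
  set x₀ := G.min' hne
  set x₁ := G.max' hne
  have hx₀ := hGmem (G.min'_mem hne)
  have hx₁ := hGmem (G.max'_mem hne)
  obtain ⟨i₀, hi₀M, hi₀⟩ := hM x₀ hx₀.1
  obtain ⟨i₁, hi₁M, hi₁⟩ := hM x₁ hx₁.1
  have hle : i₀ ≤ i₁ := le_of_mem_piece ha hi₀ hi₁ (G.min'_le_max' hne)
  have hGle : ∀ {x}, x ∈ G → x₀ ≤ x ∧ x ≤ x₁ := fun {x} h => ⟨G.min'_le x h, G.le_max' x h⟩
  obtain heq | hlt := hle.eq_or_lt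
  · have hsub : G ⊆ (F i₀).filter (· ∈ Ico s t) := fun x hx => by
      have h := hGle hx
      refine Finset.mem_filter.2 ⟨hmem.2 ⟨(hF' x (hGmem hx).1).1, ?_, ?_⟩, (hGmem hx).2⟩
      · exact hi₀.1.trans_le h.1
      · rw [heq]; exact h.2.trans hi₁.2
    have h₁ : (G.card : ℝ) ≤ ((F i₀).filter (· ∈ Ico s t)).card := by
      exact_mod_cast Finset.card_le_card hsub
    have h₂ := Finset.single_le_sum (f := fun i =>
      (((F i).offDiag.filter fun p => p.1 ∈ Ico s t ∧ p.2 ∈ Ico s t).card : ℝ))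
      (fun _ _ => Nat.cast_nonneg _) hi₀M
    simp only [← hS] at h₂
    rw [hcardF] at h₂
    nlinarith
  · have ha₁ : a (i₀ + 1) ≤ a i₁ := ha.monotone (by lia)
    have hne₀ : (F i₀).Nonempty := ⟨x₀, hmem.2 ⟨(hF' _ hx₀.1).1, hi₀⟩⟩
    -- `ρ` is the deleted point of the left interval: it lies in the window but not in `F'`, so the
    -- left interval contributes at most `p - 1` kept points.
    set ρ := (F i₀).max' hne₀
    have hρ := hmem.1 ((F i₀).max'_mem hne₀)
    have hρ₀ : x₀ ≤ ρ := (F i₀).le_max' _ (hmem.2 ⟨(hF' _ hx₀.1).1, hi₀⟩)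
    have hρF' : ρ ∉ F' := fun h => by
      obtain ⟨-, y, hy, hlt, i, hi, hyi⟩ := hF' ρ h
      obtain rfl := eq_of_mem_piece ha hi hρ.2
      exact hlt.not_ge ((F i).le_max' y (hmem.2 ⟨hy, hyi⟩))
    have hρQ : ρ ∈ (F i₀).filter (· ∈ Ico s t) :=
      Finset.mem_filter.2 ⟨(F i₀).max'_mem hne₀, hx₀.2.1.trans hρ₀, by
        linarith [hρ.2.2, hi₁.1, hx₁.2.2]⟩
    have hfin := finite_inter_Ioc hL (a (i₀ + 1)) (a i₁)
    have hsub : G ⊆ ((F i₀).filter (· ∈ Ico s t)).erase ρ ∪ hfin.toFinset ∪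
        (F i₁).filter (· ∈ Ico s t) := fun x hx => by
      have h := hGle hx
      have hxF := hGmem hx
      have hxL := (hF' x hxF.1).1
      simp only [Finset.mem_union, Finset.mem_erase, Finset.mem_filter, hmem, hfin.mem_toFinset]
      rcases le_or_gt x (a (i₀ + 1)) with h₁ | h₁
      · exact Or.inl (Or.inl ⟨fun h' => hρF' (h' ▸ hxF.1), ⟨hxL, hi₀.1.trans_le h.1, h₁⟩, hxF.2⟩)
      rcases le_or_gt x (a i₁) with h₂ | h₂
      · exact Or.inl (Or.inr ⟨hxL, h₁, h₂⟩)
      · exact Or.inr ⟨⟨hxL, h₂, h.2.trans hi₁.2⟩, hxF.2⟩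
    have h₁ := (Finset.card_le_card hsub).trans
      ((Finset.card_union_le _ _).trans (Nat.add_le_add_right (Finset.card_union_le _ _) _))
    rw [Finset.card_erase_of_mem hρQ] at h₁
    have hp₁ : 1 ≤ ((F i₀).filter (· ∈ Ico s t)).card := Finset.card_pos.2 ⟨ρ, hρQ⟩
    have hq₁ : 1 ≤ ((F i₁).filter (· ∈ Ico s t)).card := Finset.card_pos.2
      ⟨x₁, Finset.mem_filter.2 ⟨hmem.2 ⟨(hF' _ hx₁.1).1, hi₁⟩, hx₁.2⟩⟩
    have hmid : (hfin.toFinset.card : ℝ) ≤ D * (t - s) := by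
      rw [← Set.ncard_eq_toFinset_card _ hfin]
      refine (ncard_Ioc_le ha hL hD (show i₀ + 1 ≤ i₁ by lia)).trans ?_
      gcongr <;> linarith [hi₀.2, hi₁.1, hx₀.2.1, hx₁.2.2]
    have h₂ : (((F i₀).filter (· ∈ Ico s t)).card : ℝ) *
        (((F i₀).filter (· ∈ Ico s t)).card - 1) + ((F i₁).filter (· ∈ Ico s t)).card *
        (((F i₁).filter (· ∈ Ico s t)).card - 1) ≤ S := by
      rw [← hcardF, ← hcardF, ← Finset.sum_pair (f := fun i =>
        (((F i).offDiag.filter fun p => p.1 ∈ Ico s t ∧ p.2 ∈ Ico s t).card : ℝ)) hlt.ne]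
      refine Finset.sum_le_sum_of_subset_of_nonneg (fun i hi => ?_) fun _ _ _ => Nat.cast_nonneg _
      rcases Finset.mem_insert.1 hi with rfl | hi
      · exact hi₀M
      · rwa [Finset.mem_singleton.1 hi]
    have h₃ : (G.card : ℝ) ≤ (((F i₀).filter (· ∈ Ico s t)).card - 1 + hfin.toFinset.card) +
        ((F i₁).filter (· ∈ Ico s t)).card := by
      have := (Nat.cast_le (α := ℝ)).2 h₁
      push_cast [Nat.cast_sub hp₁] at this
      exact this
    have hp₂ : (1 : ℝ) ≤ ((F i₀).filter (· ∈ Ico s t)).card := by exact_mod_cast hp₁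
    have hq₂ : (1 : ℝ) ≤ ((F i₁).filter (· ∈ Ico s t)).card := by exact_mod_cast hq₁
    -- Integrality turns the linear terms in `m` into quadratic ones.
    have hmsq : (hfin.toFinset.card : ℝ) ≤ hfin.toFinset.card ^ 2 := by
      exact_mod_cast Nat.le_self_pow two_ne_zero _
    have hm₀ : (0 : ℝ) ≤ hfin.toFinset.card := Nat.cast_nonneg _
    generalize (((F i₀).filter (· ∈ Ico s t)).card : ℝ) = p at *
    generalize (((F i₁).filter (· ∈ Ico s t)).card : ℝ) = q at *
    generalize (hfin.toFinset.card : ℝ) = m at *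
    generalize (G.card : ℝ) = g at *
    have hm₂ : m ^ 2 ≤ D ^ 2 * (t - s) ^ 2 := by
      rw [← mul_pow]; gcongr
    have hg : g * (g - 1) ≤ (p - 1 + m + q) * (p - 1 + m + q - 1) := by gcongr
    have hx : (p - 1 + m + q) * (p - 1 + m + q - 1) ≤
        6 * m ^ 2 + 6 * (p * (p - 1)) + 6 * (q * (q - 1)) := by
      have e₁ := sq_nonneg (p - 1 + m - (q - 1))
      have e₂ := sq_nonneg (p - 1 - m)
      have e₃ := sq_nonneg (p - 1)
      have e₄ := sq_nonneg (q - 1)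
      nlinarith
    linarith

end UniformSequences

/-! ### Density and energy of the thinned set on the coarser partition -/

namespace UniformSequences
open Filter Set

theorem dropLast_subset (L : Set ℝ) (a : ℤ → ℝ) : dropLast L a ⊆ L := fun _ hx => hx.1

theorem not_accPt_mono {L P : Set ℝ} (hL : ∀ x : ℝ, ¬ AccPt x (𝓟 L)) (h : P ⊆ L) (x : ℝ) :
    ¬ AccPt x (𝓟 P) := fun hx => hL x (hx.mono (principal_mono.2 h))

theorem count_sub_one_le_count_dropLast {L : Set ℝ} {a : ℤ → ℝ}
    (hL : ∀ x : ℝ, ¬ AccPt x (𝓟 L)) (n : ℤ) : count L a n - 1 ≤ count (dropLast L a) a n := by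
  have hfin' : (dropLast L a ∩ piece a n).Finite :=
    finite_inter_Ioc (not_accPt_mono hL (dropLast_subset L a)) _ _
  have hone : ((L ∩ piece a n) \ (dropLast L a ∩ piece a n)).ncard ≤ 1 := by
    have hfin : (L ∩ piece a n).Finite := finite_inter_Ioc hL _ _
    rw [Set.ncard_le_one (hfin.subset sdiff_subset)]
    rintro x ⟨⟨hxL, hx⟩, hx'⟩ y ⟨⟨hyL, hy⟩, hy'⟩
    by_contra hne
    rcases lt_or_gt_of_ne hne with h | h
    · exact hx' ⟨⟨hxL, y, hyL, h, n, hx, hy⟩, hx⟩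
    · exact hy' ⟨⟨hyL, x, hxL, h, n, hy, hx⟩, hy⟩
  have := Set.ncard_le_ncard_sdiff_add_ncard (L ∩ piece a n) (dropLast L a ∩ piece a n) hfin'
  have h : ((L ∩ piece a n).ncard : ℝ) ≤ 1 + (dropLast L a ∩ piece a n).ncard := by
    exact_mod_cast this.trans (Nat.add_le_add_right hone _)
  rw [count, count]
  linarith

/-- A common point of the two closed intervals is at least as far from `0` as the old one, and
farther than the new one by at most its length, whose square is bounded by a multiple of the weight.
-/
theorem exists_weight_le {a u : ℤ → ℝ} (ha : StrictMono a) (hu : IsShortPartition u) :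
    ∃ C > 0, ∀ k i, a i ≤ u (k + 1) → u k ≤ a (i + 1) → weight a i ≤ C * weight u k := by
  obtain ⟨C, hC, hlen⟩ := hu.exists_len_le
  refine ⟨2 + 2 * C, by positivity, fun k i h₁ h₂ => ?_⟩
  have hi : a i ≤ a (i + 1) := ha.monotone (by lia)
  have hk : u k ≤ u (k + 1) := hu.strictMono.monotone (by lia)
  have e₁ := infDist_piece_le ha (y := max (a i) (u k)) (le_max_left _ _) (max_le hi h₂)
  have e₂ := abs_le_infDist_piece_add_len hu.strictMono (y := max (a i) (u k))
    (le_max_right _ _) (max_le h₁ hk)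
  have e₃ := hlen k
  have e₄ : 0 ≤ Metric.infDist 0 (piece a i) := Metric.infDist_nonneg
  have e₅ : Metric.infDist 0 (piece a i) ^ 2 ≤ (Metric.infDist 0 (piece u k) + len u k) ^ 2 := by
    gcongr; linarith
  have e₆ : weight a i = 1 + Metric.infDist 0 (piece a i) ^ 2 := rfl
  have e₇ : weight u k = 1 + Metric.infDist 0 (piece u k) ^ 2 := rfl
  nlinarith [sq_nonneg (Metric.infDist 0 (piece u k) - len u k)]

section Coarsening

variable {a u : ℤ → ℝ} {ι : ℤ → ℤ}

theorem meets_of_mem_Icc (ha : StrictMono a) (hι : ∀ k, u k ∈ piece a (ι k)) {k i : ℤ}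
    (hi : i ∈ Finset.Icc (ι k) (ι (k + 1))) : a i ≤ u (k + 1) ∧ u k ≤ a (i + 1) := by
  rw [Finset.mem_Icc] at hi
  have h₁ := ha.monotone hi.2
  have h₂ := ha.monotone (show ι k + 1 ≤ i + 1 by lia)
  exact ⟨by linarith [(hι (k + 1)).1], by linarith [(hι k).2]⟩

theorem exists_mem_Icc_of_mem_piece (ha : IsShortPartition a) (hι : ∀ k, u k ∈ piece a (ι k))
    {k : ℤ} {x : ℝ} (hx : x ∈ piece u k) : ∃ i ∈ Finset.Icc (ι k) (ι (k + 1)), x ∈ piece a i := by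
  obtain ⟨i, hi⟩ := ha.exists_mem_piece x
  exact ⟨i, Finset.mem_Icc.2 ⟨le_of_mem_piece ha.strictMono (hι k) hi hx.1.le,
    le_of_mem_piece ha.strictMono hi (hι (k + 1)) hx.2⟩, hi⟩

theorem index_mono (ha : StrictMono a) (hu : StrictMono u) (hι : ∀ k, u k ∈ piece a (ι k))
    (k : ℤ) : ι k ≤ ι (k + 1) :=
  le_of_mem_piece ha (hι k) (hι (k + 1)) (hu.monotone (by lia))

theorem index_lt (ha : StrictMono a) (hu : StrictMono u) (hι : ∀ k, u k ∈ piece a (ι k))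
    (hc : IsCoarsening a u) (k : ℤ) : ι k < ι (k + 1) := by
  refine (index_mono ha hu hι k).lt_of_ne fun h => ?_
  have h₁ := hι k
  have h₂ := hι (k + 1)
  rw [← h] at h₂
  have := hc.len_lt k (ι k) h₂.1.le h₁.2
  rw [len, len] at this
  linarith [h₁.1, h₂.2]

theorem piece_subset_Ioc (hι : ∀ k, u k ∈ piece a (ι k)) (k : ℤ) :
    piece u k ⊆ Ioc (a (ι k)) (a (ι (k + 1) + 1)) := fun _ hx =>
  ⟨(hι k).1.trans hx.1, hx.2.trans (hι (k + 1)).2⟩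

theorem Ioc_subset_piece (hι : ∀ k, u k ∈ piece a (ι k)) (k : ℤ) :
    Ioc (a (ι k + 1)) (a (ι (k + 1))) ⊆ piece u k := fun _ hx =>
  ⟨(hι k).2.trans_lt hx.1, hx.2.trans (hι (k + 1)).1.le⟩

theorem count_dropLast_le {L : Set ℝ} {D : ℝ} (ha : StrictMono a) (hu : StrictMono u)
    (hL : ∀ x : ℝ, ¬ AccPt x (𝓟 L)) (hι : ∀ k, u k ∈ piece a (ι k)) (hc : IsCoarsening a u)
    (hD₀ : 0 ≤ D) (hD : ∀ n, count L a n ≤ D * len a n) (k : ℤ) :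
    count (dropLast L a) u k ≤ 3 * D * len u k := by
  have hle := index_mono ha hu hι k
  have h₀ := meets_of_mem_Icc ha hι (Finset.left_mem_Icc.2 hle)
  have h₁ := meets_of_mem_Icc ha hι (Finset.right_mem_Icc.2 hle)
  have e₀ := hc.len_lt k _ h₀.1 h₀.2
  have e₁ := hc.len_lt k _ h₁.1 h₁.2
  have hsub : ((dropLast L a ∩ piece u k).ncard : ℝ) ≤
      (L ∩ Ioc (a (ι k)) (a (ι (k + 1) + 1))).ncard := by
    exact_mod_cast Set.ncard_le_ncard (inter_subset_inter (dropLast_subset L a)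
      (piece_subset_Ioc hι k)) (finite_inter_Ioc hL _ _)
  refine hsub.trans ((ncard_Ioc_le ha hL hD (by lia)).trans ?_)
  have h2 : a (ι (k + 1) + 1) - a (ι k) ≤ 3 * len u k := by
    have := (hι k).2
    have := (hι (k + 1)).1
    simp only [len] at *
    linarith
  nlinarith

/-- A new interval is a union of whole old ones up to two end pieces, each of length at most `η *
len u k`. Deletion costs one point per old interval, at most `η * len a i`. -/
theorem DensityCondition.dropLast {L : Set ℝ} {c : ℝ} (hd : DensityCondition c L a) (hc₀ : 0 < c)
    (ha : IsShortPartition a) (hu : StrictMono u) (hL : ∀ x : ℝ, ¬ AccPt x (𝓟 L))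
    (hc : IsCoarsening a u) : DensityCondition c (dropLast L a) u := by
  choose ι hι using fun k => ha.exists_mem_piece (u k)
  have ham := ha.strictMono
  rw [DensityCondition, ← Int.cofinite_eq, Asymptotics.isLittleO_iff]
  intro ε hε
  -- The bound `2 * η ≤ c` keeps the factor `c - 2 * η` nonnegative; `(3 + 2 * c) * η` covers the
  -- errors of `(c + η)(1 + 2η)` and `(c - 2η)(1 - 2η)` against `c`.
  obtain ⟨η, hη, hη₁, hη₂, hη₃⟩ : ∃ η > 0, η ≤ 1 ∧ 2 * η ≤ c ∧ (3 + 2 * c) * η ≤ ε := by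
    refine ⟨min 1 (min (c / 2) (ε / (3 + 2 * c))), by positivity, min_le_left _ _, ?_, ?_⟩
    · have := (min_le_right (1 : ℝ) _).trans (min_le_left (c / 2) (ε / (3 + 2 * c)))
      linarith
    · have := (min_le_right (1 : ℝ) _).trans (min_le_right (c / 2) (ε / (3 + 2 * c)))
      rwa [le_div_iff₀' (by positivity)] at this
  have hd' : ∀ᶠ i in cofinite, ‖count L a i - c * len a i‖ ≤ η * ‖len a i‖ := by
    rw [Int.cofinite_eq]; exact hd.def hη
  have hbig : ∀ᶠ i in cofinite, 1 ≤ η * len a i := by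
    filter_upwards [ha.len_tendsto_cofinite.eventually_ge_atTop (1 / η)] with i hi
    rwa [div_le_iff₀' hη] at hi
  filter_upwards [hc.len_le η hη, eventually_forall_meets hu hc.len_lt (hd'.and hbig)]
    with k hk₁ hk₂
  have hlt := index_lt ham hu hι hc k
  have hUk := len_pos hu k
  have hmeet : ∀ i, ι k ≤ i → i ≤ ι (k + 1) →
      (c - η) * len a i ≤ count L a i ∧ count L a i ≤ (c + η) * len a i ∧ 1 ≤ η * len a i ∧
      len a i ≤ η * len u k := by
    intro i h₁ h₂
    have h := meets_of_mem_Icc ham hι (Finset.mem_Icc.2 ⟨h₁, h₂⟩)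
    obtain ⟨h₃, h₄⟩ := hk₂ i h.1 h.2
    rw [Real.norm_eq_abs, Real.norm_eq_abs, abs_of_pos (len_pos ham i), abs_le] at h₃
    exact ⟨by linarith [h₃.1], by linarith [h₃.2], h₄, hk₁ i h.1 h.2⟩
  have e₀ := (hmeet _ le_rfl hlt.le).2.2.2
  have e₁ := (hmeet _ hlt.le le_rfl).2.2.2
  have hι₀ := hι k
  have hι₁ := hι (k + 1)
  have hupper : count (UniformSequences.dropLast L a) u k ≤ (c + η) * ((1 + 2 * η) * len u k) := by
    have hsub : ((UniformSequences.dropLast L a ∩ piece u k).ncard : ℝ) ≤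
        (L ∩ Ioc (a (ι k)) (a (ι (k + 1) + 1))).ncard := by
      exact_mod_cast Set.ncard_le_ncard (inter_subset_inter (dropLast_subset L a)
        (piece_subset_Ioc hι k)) (finite_inter_Ioc hL _ _)
    have hsum : ∑ i ∈ Finset.Ico (ι k) (ι (k + 1) + 1), count L a i ≤
        ∑ i ∈ Finset.Ico (ι k) (ι (k + 1) + 1), (c + η) * len a i := by
      refine Finset.sum_le_sum fun i hi => ?_
      rw [Finset.mem_Ico] at hi
      exact (hmeet i hi.1 (by lia)).2.1
    rw [← Finset.mul_sum, sum_len_Ico a (by lia), ← ncard_Ioc_eq_sum ham hL (by lia)] at hsum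
    refine (hsub.trans hsum).trans ?_
    gcongr
    simp only [len] at *
    linarith [hι₀.2, hι₁.1]
  have hlower : (c - 2 * η) * ((1 - 2 * η) * len u k) ≤
      count (UniformSequences.dropLast L a) u k := by
    have hL' := not_accPt_mono hL (dropLast_subset L a)
    have hsub : ((UniformSequences.dropLast L a ∩ Ioc (a (ι k + 1)) (a (ι (k + 1)))).ncard : ℝ) ≤
        (UniformSequences.dropLast L a ∩ piece u k).ncard := by
      exact_mod_cast Set.ncard_le_ncard (inter_subset_inter_right _ (Ioc_subset_piece hι k))
        (finite_inter_Ioc hL' _ _)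
    have hsum : ∑ i ∈ Finset.Ico (ι k + 1) (ι (k + 1)), (c - 2 * η) * len a i ≤
        ∑ i ∈ Finset.Ico (ι k + 1) (ι (k + 1)), count (UniformSequences.dropLast L a) a i := by
      refine Finset.sum_le_sum fun i hi => ?_
      rw [Finset.mem_Ico] at hi
      have h := hmeet i (by lia) (by lia)
      have := count_sub_one_le_count_dropLast (a := a) hL i
      linarith [h.1, h.2.2.1]
    rw [← Finset.mul_sum, sum_len_Ico a (by lia), ← ncard_Ioc_eq_sum ham hL' (by lia)] at hsum
    refine le_trans ?_ (hsum.trans hsub)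
    refine mul_le_mul_of_nonneg_left ?_ (by linarith)
    simp only [len] at *
    linarith [hι₀.1, hι₁.2]
  rw [Real.norm_eq_abs, Real.norm_eq_abs, abs_of_pos hUk]
  refine le_trans ?_ (mul_le_mul_of_nonneg_right hη₃ hUk.le)
  have hηsq : η * η * len u k ≤ η * len u k := by
    refine mul_le_mul_of_nonneg_right ?_ hUk.le
    nlinarith
  have hηsq' : 0 ≤ η * η * len u k := by positivity
  have hηU : 0 ≤ η * len u k := by positivity
  rw [abs_le]
  constructor <;> nlinarith

/-- Changing the scale from `l` to `R` costs at most `2 * R / l` per pair, including the `+ 2`. With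
at most `(D * l) ^ 2` pairs the cost is linear in `l`, so over the old intervals meeting a new one
it sums to `O(R ^ 2)`. -/
theorem sum_log_div_add_le {R l D : ℝ} (hl : 0 < l) (hlR : l ≤ R) {F : Finset ℝ}
    (hF : (F.card : ℝ) ≤ D * l) :
    ∑ p ∈ F.offDiag, (Real.log (R / |p.1 - p.2|) + 2) ≤ excess l F + 2 * D ^ 2 * R * l := by
  have hR := hl.trans_le hlR
  have h₁ : ∀ p ∈ F.offDiag, Real.log (R / |p.1 - p.2|) + 2 ≤
      Real.log (l / |p.1 - p.2|) + 2 * (R / l) := by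
    intro p hp
    have hp' := (abs_pos.2 (sub_ne_zero.2 (Finset.mem_offDiag.1 hp).2.2)).ne'
    have h₂ := Real.log_le_sub_one_of_pos (div_pos hR hl)
    have h₃ := (one_le_div hl).2 hlR
    rw [Real.log_div hR.ne' hl.ne'] at h₂
    rw [Real.log_div hR.ne' hp', Real.log_div hl.ne' hp']
    linarith
  refine (Finset.sum_le_sum h₁).trans ?_
  rw [Finset.sum_add_distrib, Finset.sum_const, nsmul_eq_mul, excess]
  refine add_le_add le_rfl ?_
  have h₄ : (F.offDiag.card : ℝ) ≤ (D * l) ^ 2 := by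
    rw [cast_card_offDiag]
    have : (0 : ℝ) ≤ F.card := Nat.cast_nonneg _
    nlinarith
  calc (F.offDiag.card : ℝ) * (2 * (R / l)) ≤ (D * l) ^ 2 * (2 * (R / l)) := by gcongr
    _ = _ := by field_simp

theorem EnergyCondition.dropLast {L : Set ℝ} {D : ℝ} (he : EnergyCondition L a)
    (ha : IsShortPartition a) (hu : IsShortPartition u) (hL : ∀ x : ℝ, ¬ AccPt x (𝓟 L))
    (hc : IsCoarsening a u) (hD₀ : 0 ≤ D) (hD : ∀ n, count L a n ≤ D * len a n) :
    EnergyCondition (dropLast L a) u := by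
  classical
  choose ι hι using fun k => ha.exists_mem_piece (u k)
  have ham := ha.strictMono
  have hum := hu.strictMono
  obtain ⟨F, hF⟩ := exists_finset_eq hL a
  obtain ⟨F', hF'⟩ := exists_finset_eq (not_accPt_mono hL (dropLast_subset L a)) u
  rw [energyCondition_iff ha hD hF] at he
  rw [energyCondition_iff hu (count_dropLast_le ham hum hL hι hc hD₀ hD) hF']
  obtain ⟨C, hC, hw⟩ := exists_weight_le ham hu
  have hFmem : ∀ {n x}, x ∈ F n → x ∈ piece a n := fun {n x} h => by
    rw [← Finset.mem_coe, hF] at h; exact h.2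
  have hFmem' : ∀ {n x}, x ∈ F' n → x ∈ UniformSequences.dropLast L a ∧ x ∈ piece u n :=
    fun {n x} h => by rwa [← Finset.mem_coe, hF'] at h
  have hexc : ∀ i, 0 ≤ excess (len a i) (F i) := fun i => excess_nonneg fun x hx => hFmem hx
  have hM : Summable fun k => ∑ i ∈ Finset.Icc (ι k) (ι (k + 1)),
      excess (len a i) (F i) / weight a i := by
    refine summable_sum_of_multiplicity_le
      (fun i => div_nonneg (hexc i) (weight_pos a i).le) he _ 2 fun i K hK => ?_
    refine card_le_two_of_meets hum (l := a i) (r := a (i + 1)) K (fun k hk => ?_) (hc.len_lt · i)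
    have h := meets_of_mem_Icc ham hι (hK k hk)
    exact ⟨h.1, h.2, hc.len_lt k i h.1 h.2⟩
  refine Summable.of_nonneg_of_le (fun k => div_nonneg (excess_nonneg fun x hx => (hFmem' hx).2)
    (weight_pos u k).le) (fun k => ?_)
    ((hu.short.mul_left (240 * D ^ 2)).add (hM.mul_left (24 * C)))
  have hUk := len_pos hum k
  set M := Finset.Icc (ι k) (ι (k + 1)) with hMdef
  have hlenlt : ∀ i ∈ M, len a i < len u k := fun i hi => by
    have h := meets_of_mem_Icc ham hι hi
    exact hc.len_lt k i h.1 h.2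
  have hpiece : piece u k = Ioc (u k) (u k + len u k) := by rw [piece, len]; ring_nf
  -- No isolated points are charged here, so the third family is empty.
  have hmain := sum_log_div_le (u := u k) hUk (F' k).offDiag (fun p hp => by
      obtain ⟨h₁, h₂, h₃⟩ := Finset.mem_offDiag.1 hp
      rw [← hpiece]
      exact ⟨(hFmem' h₁).2, (hFmem' h₂).2, h₃⟩) M F (fun i hi p hp => by
      obtain ⟨h₁, h₂, -⟩ := Finset.mem_offDiag.1 hp
      exact (abs_sub_le_len (hFmem h₁) (hFmem h₂)).trans (hlenlt i hi).le)
    (∅ : Finset ℤ) 0 0 (by simp) (A := 6 * D ^ 2) (B := 6) (by positivity) (by norm_num)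
    fun s t hst => by
      have := card_offDiag_dropLast_le ham hL hD₀ hD hF (F' k) (fun x hx => (hFmem' hx).1) M
        (fun x hx => exists_mem_Icc_of_mem_piece ha hι (hFmem' hx).2) hst
      simpa using this
  have hsumlen : ∑ i ∈ M, len a i ≤ 3 * len u k := by
    have hle := index_mono ham hum hι k
    have e₀ := hlenlt _ (Finset.left_mem_Icc.2 hle)
    have e₁ := hlenlt _ (Finset.right_mem_Icc.2 hle)
    have hι₀ := (hι k).2
    have hι₁ := (hι (k + 1)).1
    rw [hMdef, ← Finset.Ico_add_one_right_eq_Icc, sum_len_Ico a (by lia)]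
    simp only [len] at *
    linarith
  have hinner : ∑ i ∈ M, ∑ p ∈ (F i).offDiag, (Real.log (len u k / |p.1 - p.2|) + 2) ≤
      ∑ i ∈ M, excess (len a i) (F i) + 6 * D ^ 2 * len u k ^ 2 := by
    calc _ ≤ ∑ i ∈ M, (excess (len a i) (F i) + 2 * D ^ 2 * len u k * len a i) :=
          Finset.sum_le_sum fun i hi => sum_log_div_add_le (len_pos ham i) (hlenlt i hi).le
            (by rw [← count_eq_card (hF i)]; exact hD i)
      _ = ∑ i ∈ M, excess (len a i) (F i) + 2 * D ^ 2 * len u k * ∑ i ∈ M, len a i := by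
          rw [Finset.sum_add_distrib, Finset.mul_sum]
      _ ≤ ∑ i ∈ M, excess (len a i) (F i) + 2 * D ^ 2 * len u k * (3 * len u k) := by gcongr
      _ = _ := by ring
  have hweight : (∑ i ∈ M, excess (len a i) (F i)) / weight u k ≤
      C * ∑ i ∈ M, excess (len a i) (F i) / weight a i := by
    rw [Finset.sum_div, Finset.mul_sum]
    refine Finset.sum_le_sum fun i hi => ?_
    have h := meets_of_mem_Icc ham hι hi
    rw [← mul_div_assoc, div_le_div_iff₀ (weight_pos u k) (weight_pos a i)]
    have := mul_le_mul_of_nonneg_left (hw k i h.1 h.2) (hexc i)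
    linarith
  have hfin : excess (len u k) (F' k) ≤ 240 * D ^ 2 * len u k ^ 2 +
      24 * ∑ i ∈ M, excess (len a i) (F i) := by
    simp only [Finset.sum_empty, mul_zero, add_zero] at hmain
    rw [excess]
    linarith
  calc excess (len u k) (F' k) / weight u k
      ≤ (240 * D ^ 2 * len u k ^ 2 + 24 * ∑ i ∈ M, excess (len a i) (F i)) / weight u k :=
        div_le_div_of_nonneg_right hfin (weight_pos u k).le
    _ = 240 * D ^ 2 * (len u k ^ 2 / weight u k) +
        24 * ((∑ i ∈ M, excess (len a i) (F i)) / weight u k) := by ring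
    _ ≤ 240 * D ^ 2 * (len u k ^ 2 / weight u k) +
        24 * (C * ∑ i ∈ M, excess (len a i) (F i) / weight a i) := by gcongr
    _ = _ := by ring

end Coarsening

end UniformSequences

/-! ### Energy of the union and conclusion -/

namespace UniformSequences
open Filter Set

/-- Counting the points from `lam 0` to `lam n` bounds `|n|` by `D` times the length of the old
intervals spanned, which is a constant plus the distance and the length of the interval holding `lam
n`. -/
theorem exists_one_add_sq_le_weight {a : ℤ → ℝ} {lam : ℤ → ℝ} (ha : IsShortPartition a)
    (hlam : StrictMono lam) (hL : ∀ x : ℝ, ¬ AccPt x (𝓟 (range lam))) {D : ℝ} (hD₀ : 0 ≤ D)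
    (hD : ∀ n, count (range lam) a n ≤ D * len a n) :
    ∃ C > 0, ∀ n q : ℤ, lam n ∈ piece a q → 1 + (n : ℝ) ^ 2 ≤ C * weight a q := by
  obtain ⟨C, hC, hlen⟩ := ha.exists_len_le
  obtain ⟨p, hp⟩ := ha.exists_mem_piece (lam 0)
  set T := |a p| + |a (p + 1)|
  have ham := ha.strictMono
  refine ⟨1 + 3 * D ^ 2 * (T ^ 2 + 1 + C), by positivity, fun n q hn => ?_⟩
  have hcard : ∀ {i j k l : ℤ}, k ≤ l → lam i ∈ Ioc (a k) (a l) → lam j ∈ Ioc (a k) (a l) →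
      (j - i : ℝ) ≤ D * (a l - a k) := by
    intro i j k l hkl hi hj
    refine le_trans ?_ (ncard_Ioc_le ham hL hD hkl)
    have hsub : lam '' (Finset.Icc i j : Finset ℤ) ⊆ range lam ∩ Ioc (a k) (a l) := by
      rintro _ ⟨m, hm, rfl⟩
      rw [Finset.mem_coe, Finset.mem_Icc] at hm
      exact ⟨mem_range_self m, hi.1.trans_le (hlam.monotone hm.1),
        (hlam.monotone hm.2).trans hj.2⟩
    have h₁ := Set.ncard_le_ncard hsub (finite_inter_Ioc hL _ _)
    rw [Set.ncard_image_of_injective _ hlam.injective, Set.ncard_coe_finset, Int.card_Icc] at h₁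
    have h₂ : j - i ≤ ((range lam ∩ Ioc (a k) (a l)).ncard : ℤ) := by lia
    exact_mod_cast h₂
  have hle := ham.monotone (show q ≤ q + 1 by lia)
  have e₁ := abs_le_infDist_piece_add_len ham (y := a q) le_rfl hle
  have e₂ := abs_le_infDist_piece_add_len ham (y := a (q + 1)) hle le_rfl
  have e₃ : 0 ≤ Metric.infDist 0 (piece a q) := Metric.infDist_nonneg
  have e₄ := len_pos ham q
  have habs : |(n : ℝ)| ≤ D * (T + Metric.infDist 0 (piece a q) + len a q) := by
    rcases le_total 0 n with h | h
    · have hpq : p ≤ q := le_of_mem_piece ham hp hn (hlam.monotone h)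
      have h₁ := hcard (i := 0) (j := n) (k := p) (l := q + 1) (by lia)
        ⟨hp.1, hp.2.trans (ham.monotone (by lia))⟩ ⟨(ham.monotone hpq).trans_lt hn.1, hn.2⟩
      rw [abs_of_nonneg (by exact_mod_cast h)]
      push_cast at h₁
      rw [sub_zero] at h₁
      refine h₁.trans (mul_le_mul_of_nonneg_left ?_ hD₀)
      linarith [le_abs_self (a (q + 1)), neg_abs_le (a p), abs_nonneg (a (p + 1))]
    · have hpq : q ≤ p := le_of_mem_piece ham hn hp (hlam.monotone h)
      have h₁ := hcard (i := n) (j := 0) (k := q) (l := p + 1) (by lia)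
        ⟨hn.1, hn.2.trans (ham.monotone (by lia))⟩ ⟨(ham.monotone hpq).trans_lt hp.1, hp.2⟩
      rw [abs_of_nonpos (by exact_mod_cast h)]
      push_cast at h₁
      rw [zero_sub] at h₁
      refine h₁.trans (mul_le_mul_of_nonneg_left ?_ hD₀)
      linarith [le_abs_self (a (p + 1)), neg_abs_le (a q), abs_nonneg (a p)]
  have hw : weight a q = 1 + Metric.infDist 0 (piece a q) ^ 2 := rfl
  have hsq : (n : ℝ) ^ 2 ≤ D ^ 2 * (T + Metric.infDist 0 (piece a q) + len a q) ^ 2 := by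
    rw [← sq_abs (n : ℝ), ← mul_pow]; gcongr
  have hsq' : (T + Metric.infDist 0 (piece a q) + len a q) ^ 2 ≤
      3 * ((T ^ 2 + 1 + C) * weight a q) := by
    set δ := Metric.infDist 0 (piece a q)
    have h₁ : (T + δ + len a q) ^ 2 ≤ 3 * (T ^ 2 + δ ^ 2 + len a q ^ 2) := by
      nlinarith [sq_nonneg (T - δ), sq_nonneg (T - len a q), sq_nonneg (δ - len a q)]
    have h₂ : T ^ 2 ≤ T ^ 2 * weight a q :=
      le_mul_of_one_le_right (sq_nonneg _) (one_le_weight a q)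
    linarith [hlen q]
  have := one_le_weight a q
  calc 1 + (n : ℝ) ^ 2
      ≤ weight a q + D ^ 2 * (3 * ((T ^ 2 + 1 + C) * weight a q)) :=
        add_le_add this (hsq.trans (by gcongr))
    _ = _ := by ring

theorem DensityCondition.union {c d : ℝ} {L G : Set ℝ} {u : ℤ → ℝ}
    (hc : DensityCondition c L u) (hd : DensityCondition d G u)
    (hL : ∀ x : ℝ, ¬ AccPt x (𝓟 L)) (hG : ∀ x : ℝ, ¬ AccPt x (𝓟 G)) (hdisj : Disjoint L G) :
    DensityCondition (c + d) (L ∪ G) u := by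
  refine (Asymptotics.IsLittleO.add hc hd).congr_left fun n => ?_
  have hL' : (L ∩ piece u n).Finite := finite_inter_Ioc hL _ _
  have hG' : (G ∩ piece u n).Finite := finite_inter_Ioc hG _ _
  rw [count, count, count, union_inter_distrib_right, Set.ncard_union_eq
    (hdisj.mono inter_subset_left inter_subset_left) hL' hG']
  push_cast; ring

theorem not_accPt_union {L G : Set ℝ} (hL : ∀ x : ℝ, ¬ AccPt x (𝓟 L))
    (hG : ∀ x : ℝ, ¬ AccPt x (𝓟 G)) (x : ℝ) : ¬ AccPt x (𝓟 (L ∪ G)) := by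
  rw [← sup_principal, accPt_sup, not_or]
  exact ⟨hL x, hG x⟩

/-- The energy of a union, where the points `lam n`, `n ∈ X`, of the first set stay at distance
`ℓ n / 2` from the second set. -/
theorem excess_union_le {v R D : ℝ} (hR : 1 ≤ R) {FL FG : Finset ℝ}
    (hFL : ∀ x ∈ FL, x ∈ Ioc v (v + R)) (hFG : ∀ x ∈ FG, x ∈ Ioc v (v + R))
    (hcL : (FL.card : ℝ) ≤ D * R) (hcG : (FG.card : ℝ) ≤ D * R)
    {lam ℓ : ℤ → ℝ} (hlam : StrictMono lam) (hℓ : ∀ n, 0 < ℓ n) (X : Finset ℤ)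
    (hX : X.image lam = FL) (hsep : ∀ n ∈ X, ∀ y ∈ FG, ℓ n / 2 ≤ |lam n - y|) :
    excess R (FL ∪ FG) ≤ 12 * excess R FL + 12 * excess R FG + (48 * D ^ 2 + 36 * D) * R ^ 2 +
      12 * ∑ n ∈ X, max (-Real.log (ℓ n)) 0 := by
  have hR₀ : 0 < R := by linarith
  have hdisj : Disjoint FL FG := by
    rw [Finset.disjoint_left, ← hX]
    intro x hx hxG
    obtain ⟨n, hn, rfl⟩ := Finset.mem_image.1 hx
    have := hsep n hn _ hxG
    rw [sub_self, abs_zero] at this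
    linarith [hℓ n]
  have hmem : ∀ x ∈ FL ∪ FG, x ∈ Ioc v (v + R) := fun x hx =>
    (Finset.mem_union.1 hx).elim (hFL x) (hFG x)
  have hdist : ∀ x ∈ FL ∪ FG, ∀ y ∈ FL ∪ FG, |x - y| ≤ R := fun x hx y hy => by
    have h₁ := hmem x hx
    have h₂ := hmem y hy
    rw [abs_le]; constructor <;> linarith [h₁.1, h₁.2, h₂.1, h₂.2]
  have hmain := sum_log_div_le (u := v) hR₀ (FL ∪ FG).offDiag (fun p hp => by
      obtain ⟨h₁, h₂, h₃⟩ := Finset.mem_offDiag.1 hp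
      exact ⟨hmem _ h₁, hmem _ h₂, h₃⟩) (Finset.univ : Finset Bool) (fun b => cond b FL FG)
    (fun b _ p hp => by
      obtain ⟨h₁, h₂, -⟩ := Finset.mem_offDiag.1 hp
      cases b
      · exact hdist _ (Finset.mem_union_right _ h₁) _ (Finset.mem_union_right _ h₂)
      · exact hdist _ (Finset.mem_union_left _ h₁) _ (Finset.mem_union_left _ h₂))
    -- The separation radius is capped at `R`, as the cell count needs scales of at most `R`.
    X lam (fun n => min (ℓ n / 2) R) (fun n _ => ⟨lt_min (half_pos (hℓ n)) hR₀, min_le_right _ _⟩)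
    (A := 0) (B := 3) le_rfl (by norm_num) fun s t hst => by
      rw [Fintype.sum_bool]
      simp only [cond_true, cond_false]
      rw [cast_card_offDiag_filter, cast_card_offDiag_filter, cast_card_offDiag_filter,
        Finset.filter_union, Finset.card_union_of_disjoint
        (Finset.disjoint_filter_filter hdisj)]
      rcases (FL.filter (· ∈ Ico s t)).eq_empty_or_nonempty with h₁ | ⟨x, hx⟩
      · rw [h₁, Finset.card_empty, zero_add, Nat.cast_zero]
        have h₂ : (0 : ℝ) ≤ (FG.filter (· ∈ Ico s t)).card *
            ((FG.filter (· ∈ Ico s t)).card - 1) := by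
          rw [← cast_card_offDiag]; positivity
        have h₃ : (0 : ℝ) ≤ (X.filter fun n => lam n ∈ Ico s t ∧ min (ℓ n / 2) R < t - s).card :=
          Nat.cast_nonneg _
        linarith
      rcases (FG.filter (· ∈ Ico s t)).eq_empty_or_nonempty with h₁ | ⟨y, hy⟩
      · rw [h₁, Finset.card_empty, add_zero, Nat.cast_zero]
        have h₂ : (0 : ℝ) ≤ (FL.filter (· ∈ Ico s t)).card *
            ((FL.filter (· ∈ Ico s t)).card - 1) := by
          rw [← cast_card_offDiag]; positivity
        have h₃ : (0 : ℝ) ≤ (X.filter fun n => lam n ∈ Ico s t ∧ min (ℓ n / 2) R < t - s).card :=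
          Nat.cast_nonneg _
        linarith
      obtain ⟨hxF, hxQ⟩ := Finset.mem_filter.1 hx
      obtain ⟨hyF, hyQ⟩ := Finset.mem_filter.1 hy
      rw [← hX] at hxF
      obtain ⟨n, hn, rfl⟩ := Finset.mem_image.1 hxF
      -- Both sets meet the window, so it is longer than `ℓ n / 2` for its point `lam n`. This one
      -- charge covers the case `p = q = 1`, where neither set has a pair of its own.
      have hXpos : (1 : ℝ) ≤
          (X.filter fun n => lam n ∈ Ico s t ∧ min (ℓ n / 2) R < t - s).card := by
        refine Nat.one_le_cast.2 (Finset.card_pos.2 ⟨n, Finset.mem_filter.2 ⟨hn, hxQ, ?_⟩⟩)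
        refine (min_le_left _ _).trans_lt ((hsep n hn y hyF).trans_lt ?_)
        rw [abs_lt]; constructor <;> linarith [hxQ.1, hxQ.2, hyQ.1, hyQ.2]
      push_cast
      generalize ((FL.filter (· ∈ Ico s t)).card : ℝ) = p
      generalize ((FG.filter (· ∈ Ico s t)).card : ℝ) = q
      nlinarith [sq_nonneg (p - q), sq_nonneg (p - 1), sq_nonneg (q - 1)]
  rw [Fintype.sum_bool] at hmain
  simp only [cond_true, cond_false] at hmain
  have hL := sum_log_div_add_le hR₀ le_rfl hcL
  have hG := sum_log_div_add_le hR₀ le_rfl hcG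
  have hXcard : (X.card : ℝ) ≤ D * R := by
    rwa [← hX, Finset.card_image_of_injective _ hlam.injective] at hcL
  have hσ : ∑ n ∈ X, (Real.log (R / min (ℓ n / 2) R) + 2) ≤
      3 * D * R ^ 2 + ∑ n ∈ X, max (-Real.log (ℓ n)) 0 := by
    calc _ ≤ ∑ n ∈ X, (3 * R + max (-Real.log (ℓ n)) 0) := by
          refine Finset.sum_le_sum fun n _ => ?_
          have h₁ := Real.log_le_sub_one_of_pos hR₀
          have h₂ := le_max_left (-Real.log (ℓ n)) 0
          have h₃ := le_max_right (-Real.log (ℓ n)) 0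
          rcases le_total (ℓ n / 2) R with h | h
          · rw [min_eq_left h, Real.log_div hR₀.ne' (half_pos (hℓ n)).ne',
              Real.log_div (hℓ n).ne' two_ne_zero]
            linarith [Real.log_two_lt_d9]
          · rw [min_eq_right h, div_self hR₀.ne', Real.log_one]
            linarith
      _ = X.card * (3 * R) + ∑ n ∈ X, max (-Real.log (ℓ n)) 0 := by
          rw [Finset.sum_add_distrib, Finset.sum_const, nsmul_eq_mul]
      _ ≤ _ := by nlinarith
  rw [excess]
  linarith

end UniformSequences

open UniformSequences Filter Set in
-- The intervals around the points enter through the separation `ℓ n / 2` between `lam n` and `G`,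
-- which is inherited by the thinned sets.
theorem UniformSequences.IsUniform.exists_union_subset (c d : ℝ) (lam : ℤ → ℝ) (G : Set ℝ)
    (hlam : StrictMono lam) (hL : IsUniform c (range lam)) (hG : IsUniform d G) (ℓ : ℤ → ℝ)
    (hℓ : ∀ n, 0 < ℓ n)
    (hlog : Summable fun n : ℤ => max (-Real.log (ℓ n)) 0 / (1 + (n : ℝ) ^ 2))
    (hsep : ∀ n, ∀ y ∈ G, ℓ n / 2 ≤ |lam n - y|) :
    ∃ P : Set ℝ, P ⊆ range lam ∪ G ∧ IsUniform (c + d) P := by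
  classical
  obtain ⟨a, ha, hda, hea⟩ := hL.exists_partition
  obtain ⟨b, hb, hdb, heb⟩ := hG.exists_partition
  obtain ⟨u, hu, hu₁, hca, hcb⟩ := exists_common_coarsening ha hb
  obtain ⟨Da, hDa₀, hDa⟩ := hda.exists_count_le ha.strictMono
  obtain ⟨Db, hDb₀, hDb⟩ := hdb.exists_count_le hb.strictMono
  set L' := dropLast (range lam) a
  set G' := dropLast G b
  have hLs : L' ⊆ range lam := dropLast_subset _ _
  have hGs : G' ⊆ G := dropLast_subset _ _
  have hLd := not_accPt_mono hL.discrete hLs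
  have hGd := not_accPt_mono hG.discrete hGs
  have hdL : DensityCondition c L' u := hda.dropLast hL.pos ha hu.strictMono hL.discrete hca
  have hdG : DensityCondition d G' u := hdb.dropLast hG.pos hb hu.strictMono hG.discrete hcb
  have heL : EnergyCondition L' u := hea.dropLast ha hu hL.discrete hca hDa₀.le hDa
  have heG : EnergyCondition G' u := heb.dropLast hb hu hG.discrete hcb hDb₀.le hDb
  have hdisj : Disjoint L' G' := Set.disjoint_left.2 fun x hx hxG => by
    obtain ⟨n, rfl⟩ := hLs hx
    have := hsep n _ (hGs hxG)
    rw [sub_self, abs_zero] at this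
    linarith [hℓ n]
  have hdU := hdL.union hdG hLd hGd hdisj
  refine ⟨L' ∪ G', union_subset_union hLs hGs, add_pos hL.pos hG.pos, not_accPt_union hLd hGd, u,
    hu, hdU, ?_⟩
  obtain ⟨D₁, hD₁₀, hD₁⟩ := hdL.exists_count_le hu.strictMono
  obtain ⟨D₂, hD₂₀, hD₂⟩ := hdG.exists_count_le hu.strictMono
  obtain ⟨D₃, -, hD₃⟩ := hdU.exists_count_le hu.strictMono
  obtain ⟨FL, hFL⟩ := exists_finset_eq hLd u
  obtain ⟨FG, hFG⟩ := exists_finset_eq hGd u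
  have hFU : ∀ k, ((FL k ∪ FG k : Finset ℝ) : Set ℝ) = (L' ∪ G') ∩ piece u k := fun k => by
    rw [Finset.coe_union, hFL, hFG, union_inter_distrib_right]
  rw [energyCondition_iff hu hD₁ hFL] at heL
  rw [energyCondition_iff hu hD₂ hFG] at heG
  rw [energyCondition_iff hu hD₃ hFU]
  have hLmem : ∀ {k x}, x ∈ FL k → x ∈ L' ∧ x ∈ piece u k := fun {k x} h => by
    rwa [← Finset.mem_coe, hFL] at h
  have hGmem : ∀ {k x}, x ∈ FG k → x ∈ G' ∧ x ∈ piece u k := fun {k x} h => by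
    rwa [← Finset.mem_coe, hFG] at h
  set X : ℤ → Finset ℤ := fun k => (FL k).preimage lam hlam.injective.injOn
  have hXmem : ∀ {k n}, n ∈ X k ↔ lam n ∈ FL k := fun {k n} => Finset.mem_preimage
  have hXimage : ∀ k, (X k).image lam = FL k := fun k => by
    ext x
    rw [Finset.mem_image]
    constructor
    · rintro ⟨n, hn, rfl⟩; exact hXmem.1 hn
    · intro hx
      obtain ⟨n, rfl⟩ := hLs (hLmem hx).1
      exact ⟨n, hXmem.2 hx, rfl⟩
  -- Each index belongs to one new interval only, hence multiplicity `1`.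
  have hXsum : Summable fun k => ∑ n ∈ X k, max (-Real.log (ℓ n)) 0 / (1 + (n : ℝ) ^ 2) := by
    refine summable_sum_of_multiplicity_le
      (fun n => div_nonneg (le_max_right _ _) (by positivity)) hlog X 1 fun n K hK => ?_
    rw [Finset.card_le_one]
    intro k hk m hm
    exact eq_of_mem_piece hu.strictMono (hLmem (hXmem.1 (hK k hk))).2
      (hLmem (hXmem.1 (hK m hm))).2
  obtain ⟨C₁, hC₁, hw₁⟩ := exists_one_add_sq_le_weight ha hlam hL.discrete hDa₀.le hDa
  obtain ⟨C₂, hC₂, hw₂⟩ := exists_weight_le ha.strictMono hu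
  have hweight : ∀ k, (∑ n ∈ X k, max (-Real.log (ℓ n)) 0) / weight u k ≤
      C₁ * C₂ * ∑ n ∈ X k, max (-Real.log (ℓ n)) 0 / (1 + (n : ℝ) ^ 2) := by
    intro k
    rw [Finset.sum_div, Finset.mul_sum]
    refine Finset.sum_le_sum fun n hn => ?_
    have hnu := (hLmem (hXmem.1 hn)).2
    obtain ⟨q, hq⟩ := ha.exists_mem_piece (lam n)
    have h₁ := hw₁ n q hq
    have h₂ := hw₂ k q (hq.1.le.trans hnu.2) (hnu.1.le.trans hq.2)
    rw [← mul_div_assoc, div_le_div_iff₀ (weight_pos u k) (by positivity)]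
    have h₃ : 1 + (n : ℝ) ^ 2 ≤ C₁ * C₂ * weight u k := by
      rw [mul_assoc]; exact h₁.trans (by gcongr)
    have := mul_le_mul_of_nonneg_left h₃ (le_max_right (-Real.log (ℓ n)) 0)
    linarith
  set D := max D₁ D₂
  refine Summable.of_nonneg_of_le (fun k => div_nonneg (excess_nonneg fun x hx =>
      (Finset.mem_union.1 hx).elim (fun h => (hLmem h).2) fun h => (hGmem h).2)
    (weight_pos u k).le) (fun k => ?_)
    ((((heL.mul_left 12).add (heG.mul_left 12)).add
      (hu.short.mul_left (48 * D ^ 2 + 36 * D))).add (hXsum.mul_left (12 * (C₁ * C₂))))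
  have hpiece : piece u k = Ioc (u k) (u k + len u k) := by rw [piece, len]; ring_nf
  have hlen : 0 ≤ len u k := (zero_le_one.trans (hu₁ k))
  have hle := excess_union_le (v := u k) (D := D) (hu₁ k)
    (fun x hx => by rw [← hpiece]; exact (hLmem hx).2)
    (fun x hx => by rw [← hpiece]; exact (hGmem hx).2)
    (by
      rw [← count_eq_card (hFL k)]
      exact (hD₁ k).trans (mul_le_mul_of_nonneg_right (le_max_left _ _) hlen))
    (by
      rw [← count_eq_card (hFG k)]
      exact (hD₂ k).trans (mul_le_mul_of_nonneg_right (le_max_right _ _) hlen))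
    hlam hℓ (X k) (hXimage k) fun n _ y hy => hsep n y (hGs (hGmem hy).1)
  have := hweight k
  refine (div_le_div_of_nonneg_right hle (weight_pos u k).le).trans ?_
  rw [add_div, add_div, add_div, mul_div_assoc, mul_div_assoc, mul_div_assoc, mul_div_assoc]
  linarith

theorem lemma9p3 (c d : ℝ) (lam : ℤ → ℝ) (G : Set ℝ)
    (hlam : StrictMono lam)
    (hL : UniformSequences.IsUniform c (Set.range lam))
    (hG : UniformSequences.IsUniform d G)
    (I : ℤ → Set ℝ) (ℓ : ℤ → ℝ)
    (hℓ : ∀ n, 0 < ℓ n)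
    (hI_lower : ∀ n, Set.Ioo (lam n - ℓ n / 2) (lam n + ℓ n / 2) ⊆ I n)
    (hI_upper : ∀ n, I n ⊆ Set.Icc (lam n - ℓ n / 2) (lam n + ℓ n / 2))
    (hdisj : Pairwise fun m n => Disjoint (I m) (I n))
    (hdist : ∀ n, ℓ n ≤ 1 / 3 * Metric.infDist (lam n) (Set.range lam \ {lam n}))
    (hlog : Summable fun n : ℤ => max (-Real.log (ℓ n)) 0 / (1 + (n : ℝ) ^ 2))
    (hGI : G ∩ (⋃ n, I n) = ∅) :
    ∃ P : Set ℝ, P ⊆ Set.range lam ∪ G ∧ UniformSequences.IsUniform (c + d) P := by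
  refine hL.exists_union_subset c d lam G hlam hG ℓ hℓ hlog fun n y hy => ?_
  by_contra! h
  have hmem : y ∈ G ∩ ⋃ n, I n := by
    refine ⟨hy, Set.mem_iUnion.2 ⟨n, hI_lower n ?_⟩⟩
    rw [abs_lt] at h
    exact ⟨by linarith [h.2], by linarith [h.1]⟩
  rw [hGI] at hmem
  exact hmem
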